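/- Let $X$ and $Z$ be complex $N\times N$ matrices with $X$ invertible and diagonalizable and $\operatorname{rank}(XZX^{-1}-Z+I)=1$ (that is, $(X,Z)$ represents a point of the trigonometric Calogero–Moser space $C_N^{\rm trig}$). For $x,y\in\mathbb C^N$ put $K(x)=\operatorname{diag}(e^{x_1/2},\dots,e^{x_N/2})$ and let $L(x,y)$ be the matrix with entries $L_{ii}=y_i$ and $L_{ij}=\frac{1}{2\sinh((x_i-x_j)/2)}$ for $i\ne j$. For $k\ge 1$ let $$H_k(x,y)=\frac1{k+1}\operatorname{tr}\{(L(x,y)-I)^{k+1}-L(x,y)^{k+1}\}.$$ For a sequence of complex times $t=(t_1,t_2,\dots)$ put $$\tau_{(X,Y,Z)}(t)=\det\Big\{I-X\exp\Big(-\sum_{k\ge1}t_kZ^k\Big)\exp\Big(\sum_{k\ge1}t_kY^k\Big)\Big\}.$$ Then there are an invertible matrix $U$ and $(x_0,y_0)\in\mathbb C^{2N}$ with $U^{-1}XU=K(x_0)^2$ and $U^{-1}ZU=L(x_0,y_0)$. For all such $U$, $x_0$, $y_0$: 1. the numbers $e^{x_{0,1}},\dots,e^{x_{0,N}}$ are pairwise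 distinct; 2. for some $R,\varepsilon>0$, the trigonometric Calogero–Moser hierarchy $$\frac{\partial x_i}{\partial t_k}=\frac{\partial H_k}{\partial y_i}(x,y),\qquad \frac{\partial y_i}{\partial t_k}=-\frac{\partial H_k}{\partial x_i}(x,y)\qquad(k\ge1,\ 1\le i\le N)$$ has a solution $(x(t),y(t))$ without collisions and with $(x(0),y(0))=(x_0,y_0)$ on the ball $\sum_k|t_k|R^k<\varepsilon$, and $\sum_k t_kZ^k$ and $\sum_k t_k(Z-I)^k$ converge there; 3. for every solution $(x(t),y(t))$ of this hierarchy without collisions (that is, $e^{x_i(t)}\neq e^{x_j(t)}$ for $i\ne j$) and with $(x(0),y(0))=(x_0,y_0)$, on any set of times $\Omega\ni 0$ in which the truncations of each $t\in\Omega$ are, from some point on, reached from $0$ by finitely many moves, each changing one time $t_k$ along a segment, for every $t\in\Omega$ for which $\sum_k t_kZ^k$ and $\sum_k t_k(Z-I)^k$ converge, and for every $x\in\mathbb C$, $$\tau_{(X,Z-I,Z)}(x+t_1,t_2,t_3,\dots)=e^{\sum_{i=1}^N (x_i(t)-x)/2}\ \prod_{i=1}^N 2\sinh\frac{x-x_i(t)}2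 .$$ Here the derivatives in $t_k$ are taken within $\Omega$, and a solution is required to satisfy $(x(t),y(t))=\lim_{m\to\infty}(x,y)(t_1,\dots,t_m,0,0,\dots)$ for every $t\in\Omega$, which is automatic for finitely many non-zero times; convergence of the matrix series is unconditional (equivalently, absolute). -/

import Mathlib

open Filter Topology

noncomputable section

/-- A matrix is diagonalizable if it is similar to a diagonal matrix. -/
def MatrixDiagonalizable {N : ℕ} (X : Matrix (Fin N) (Fin N) ℂ) : Prop :=
  ∃ (P : Matrix (Fin N) (Fin N) ℂ) (d : Fin N → ℂ),
    IsUnit P ∧ P⁻¹ * X * P = Matrix.diagonal d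

/-- `(X, Z)` represents a point of the trigonometric Calogero-Moser space `C_N^trig`:
`X` is invertible and `X Z X⁻¹ - Z + I` has rank one. -/
structure IsTrigCMPair {N : ℕ} (X Z : Matrix (Fin N) (Fin N) ℂ) : Prop where
  isUnit : IsUnit X
  rank_eq_one : (X * Z * X⁻¹ - Z + 1).rank = 1

/-- The series `∑ t_k Z^k` and `∑ t_k (Z - I)^k` converge. Times are sequences
`t = (t_1, t_2, …)`, indexed by the positive integers. -/
def TimesConverge {N : ℕ} (Z : Matrix (Fin N) (Fin N) ℂ) (t : ℕ+ → ℂ) : Prop :=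
  Summable (fun k : ℕ+ => t k • Z ^ (k : ℕ)) ∧
    Summable (fun k : ℕ+ => t k • (Z - 1) ^ (k : ℕ))

/-- The determinantal tau function
`τ_{(X,Y,Z)}(t) = det (I - X exp(-∑ t_k Z^k) exp(∑ t_k Y^k))`. -/
def tauDet {N : ℕ} (X Y Z : Matrix (Fin N) (Fin N) ℂ) (t : ℕ+ → ℂ) : ℂ :=
  (1 - X * NormedSpace.exp (-∑' k : ℕ+, t k • Z ^ (k : ℕ))
      * NormedSpace.exp (∑' k : ℕ+, t k • Y ^ (k : ℕ))).det

/-- The time sequence `(ξ + t_1, t_2, t_3, …)`. -/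
def shiftFirst (ξ : ℂ) (t : ℕ+ → ℂ) : ℕ+ → ℂ :=
  Function.update t 1 (ξ + t 1)

/-- The matrix `K(x) = diag(e^{x_1/2}, …, e^{x_N/2})`. -/
def matK {N : ℕ} (x : Fin N → ℂ) : Matrix (Fin N) (Fin N) ℂ :=
  Matrix.diagonal fun i => Complex.exp (x i / 2)

/-- Moser's Lax matrix: diagonal entries `y_i`, off-diagonal entries
`1 / (2 sinh((x_i - x_j)/2))`. -/
def laxMatrix {N : ℕ} (x y : Fin N → ℂ) : Matrix (Fin N) (Fin N) ℂ :=
  Matrix.of fun i j => if i = j then y i else 1 / (2 * Complex.sinh ((x i - x j) / 2))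

/-- Configurations without collisions: the locus on which the Lax matrix is defined. -/
def CollisionFree {N : ℕ} (x : Fin N → ℂ) : Prop :=
  ∀ i j, i ≠ j → Complex.sinh ((x i - x j) / 2) ≠ 0

/-- `(x₀, y₀)` is obtained from `(X, Z)` through the conjugation
`U⁻¹ X U = K²(x₀)`, `U⁻¹ Z U = L(x₀, y₀)`. -/
structure IsDiagonalizingData {N : ℕ} (X Z U : Matrix (Fin N) (Fin N) ℂ)
    (x₀ y₀ : Fin N → ℂ) : Prop where
  isUnit : IsUnit U
  conj_X : U⁻¹ * X * U = matK x₀ ^ 2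
  conj_Z : U⁻¹ * Z * U = laxMatrix x₀ y₀

/-- The Hamiltonians of the trigonometric Calogero-Moser hierarchy,
`H_k(x, y) = (1/(k+1)) tr ((L(x,y) - I)^(k+1) - L(x,y)^(k+1))`, `k = 1, 2, …`. -/
def trigHamiltonian {N : ℕ} (k : ℕ+) (x y : Fin N → ℂ) : ℂ :=
  1 / (((k : ℕ) : ℂ) + 1) *
    ((laxMatrix x y - 1) ^ ((k : ℕ) + 1) - laxMatrix x y ^ ((k : ℕ) + 1)).trace

/-- The partial derivative `∂H_k/∂x_i`. -/
def dHdx {N : ℕ} (k : ℕ+) (i : Fin N) (x y : Fin N → ℂ) : ℂ :=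
  deriv (fun s => trigHamiltonian k (Function.update x i s) y) (x i)

/-- The partial derivative `∂H_k/∂y_i`. -/
def dHdy {N : ℕ} (k : ℕ+) (i : Fin N) (x y : Fin N → ℂ) : ℂ :=
  deriv (fun s => trigHamiltonian k x (Function.update y i s)) (y i)

/-- The truncation `(t_1, …, t_m, 0, 0, …)`. -/
def truncTimes (m : ℕ) (t : ℕ+ → ℂ) : ℕ+ → ℂ :=
  fun k => if (k : ℕ) ≤ m then t k else 0

/-- One passes from `t` to `t'` by changing a single time `t_k` along a straight segment of the
complex plane, without leaving `Ω`. -/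
def TimeStep (Ω : Set (ℕ+ → ℂ)) (t t' : ℕ+ → ℂ) : Prop :=
  ∃ (k : ℕ+) (b : ℂ), t' = Function.update t k b ∧
    ∀ s ∈ segment ℝ (t k) b, Function.update t k s ∈ Ω

/-- Sets of times on which a solution issued from `t = 0` can live: `0 ∈ Ω`, and for `t ∈ Ω` the
truncations of `t` (eventually) are reached from `0`, inside `Ω`, by finitely many moves each of
which changes a single time. -/
structure IsTimeDomain (Ω : Set (ℕ+ → ℂ)) : Prop where
  zero_mem : 0 ∈ Ω
  reach : ∀ t ∈ Ω, ∀ᶠ m : ℕ in atTop, Relation.ReflTransGen (TimeStep Ω) 0 (truncTimes m t)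

/-- `(x(t), y(t))`, `t ∈ Ω`, is a solution of the trigonometric Calogero-Moser hierarchy with
initial condition `(x₀, y₀)`: it is collision free, follows the Hamiltonian vector field of `H_k`
in the time `t_k` for every `k`, and its value at `t = (t_1, t_2, …)` is the limit of
its values at `(t_1, …, t_m, 0, 0, …)` (which is automatic if `t` has finite support).
The derivative in `t_k` is the complex one at interior points of the slice of `Ω`. -/
structure IsTrigCMSolution {N : ℕ} (x₀ y₀ : Fin N → ℂ) (Ω : Set (ℕ+ → ℂ))
    (x y : (ℕ+ → ℂ) → Fin N → ℂ) : Prop where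
  domain : IsTimeDomain Ω
  init_x : x 0 = x₀
  init_y : y 0 = y₀
  collisionFree : ∀ t ∈ Ω, CollisionFree (x t)
  flow_x : ∀ t ∈ Ω, ∀ (k : ℕ+) (i : Fin N),
    HasDerivWithinAt (fun s => x (Function.update t k s) i) (dHdy k i (x t) (y t))
      {s | Function.update t k s ∈ Ω} (t k)
  flow_y : ∀ t ∈ Ω, ∀ (k : ℕ+) (i : Fin N),
    HasDerivWithinAt (fun s => y (Function.update t k s) i) (-dHdx k i (x t) (y t))
      {s | Function.update t k s ∈ Ω} (t k)
  tendsto_x : ∀ t ∈ Ω, Tendsto (fun m : ℕ => x (truncTimes m t)) atTop (𝓝 (x t))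
  tendsto_y : ∀ t ∈ Ω, Tendsto (fun m : ℕ => y (truncTimes m t)) atTop (𝓝 (y t))

/-- The ball `∑ |t_k| R^k < ε` of time sequences. -/
def smallTimes (R ε : ℝ) : Set (ℕ+ → ℂ) :=
  {t | Summable (fun k : ℕ+ => ‖t k‖ * R ^ (k : ℕ)) ∧ ∑' k : ℕ+, ‖t k‖ * R ^ (k : ℕ) < ε}

end

/-!
Up to conjugation the flows are explicit. Write `u_i = e^{x_i/2}`, `Q = K(x)² = diag(u_i²)`
and `L = L(x, y)`. Off the diagonal `L_{ij} = u_i u_j / (u_i² - u_j²)`, which says exactly that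
`Q L - L Q + Q = u uᵀ`, the rank one condition. In a basis where `X` is diagonal this condition
factorizes the entries of `Z`; the diagonal entries show that no factor vanishes, so that the
eigenvalues of `X` are distinct, and rescaling the eigenvectors makes both factors equal to `u`
(`IsTrigCMPair.exists_diagonalizingData`, `IsDiagonalizingData.collisionFree`).

With `Φ = L^k - (L - 1)^k`, the `k`-th Hamiltonian flow has the Lax form `Q' = [Q, M] - Q Φ`,
`L' = [L, M]` for a suitable `M` (`exists_lax_pair`, `exists_hasDerivWithinAt_lax`); the vanishing
of the diagonal of `[L, Φ]` is what makes the equations for `M` compatible. Hence `(Q, L)` is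
conjugate to `(X e^{-∑ t_k (Z^k - (Z-1)^k)}, Z)`. No conjugating matrix has to be constructed for
the determinant formula: it suffices that `det (1 - c Q e^A)` is stationary in the direction
`([Q, M] - Q B, [A, M] + B)` when `B` commutes with `A` (`hasDerivWithinAt_det_one_sub`). Applied
to `A = p(L) - (b - s) Φ`, with an arbitrary polynomial `p`, it carries the determinants
`det (1 - c Q e^{p(L)})` across a move in a single time, and an induction over the moves computes
them (`det_one_sub_eq_of_reach`). A limit over truncations gives the formula for the tau function,
since the shift of `t_1` by `ξ` multiplies `X` by the scalar `e^{-ξ}`.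

For existence, the matrix `K(x₀)² e^{-∑ t_k (L₀^k - (L₀-1)^k)}` is diagonalized near `t = 0` by
the implicit function theorem, with eigenvectors scaled by `V K(x) e = K(x₀) e`
(`exists_local_diagonalization`). The commutator relation shows that `V⁻¹ L₀ V` is a Lax matrix
(`conj_laxMatrix_eq`), and differentiating `V K(x)² = A V` gives the Hamiltonian equations
(`hasDerivAt_of_diagonalization`).
-/

/-! ### The Lax pair -/

section LaxAlgebra

variable {N : ℕ}

/-- The diagonal part of `[L, M]` is the trace of `Φ` against the derivative of `L` in the `i`-th
position. Only the off-diagonal entries of `M` enter, and the two sides differ by a multiple of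
`[L, Φ]_ii = 0`. -/
lemma lax_commutator_diag {u : Fin N → ℂ}
    (hd : ∀ i j, i ≠ j → u i ^ 2 - u j ^ 2 ≠ 0) {L Φ M : Matrix (Fin N) (Fin N) ℂ}
    (hL : ∀ i j, i ≠ j → L i j = u i * u j / (u i ^ 2 - u j ^ 2)) (hc : L * Φ = Φ * L)
    (hM : ∀ i j, i ≠ j → M i j = u i ^ 2 * Φ i j / (u i ^ 2 - u j ^ 2)) (i : Fin N) :
    (L * M - M * L) i i = ∑ b, (Φ b i - Φ i b) *
      (-(u i * u b * (u i ^ 2 + u b ^ 2)) / (2 * (u i ^ 2 - u b ^ 2) ^ 2)) := by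
  have h0 : ∑ b, (L i b * Φ b i - Φ i b * L b i) = 0 := by
    have := congrFun (congrFun hc i) i
    simp only [Matrix.mul_apply] at this
    rw [Finset.sum_sub_distrib, this, sub_self]
  have : (L * M - M * L) i i = ∑ b, (L i b * M b i - M i b * L b i) := by
    simp [Matrix.mul_apply]
  rw [this, ← sub_zero (∑ b, _), ← zero_div 2, ← h0, Finset.sum_div, ← Finset.sum_sub_distrib]
  refine Finset.sum_congr rfl fun b _ => ?_
  by_cases hb : b = i
  · subst hb; simp [mul_comm]
  · rw [hL i b (Ne.symm hb), hL b i hb, hM i b (Ne.symm hb), hM b i hb]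
    have h1 := hd i b (Ne.symm hb)
    have h2 := hd b i hb
    have h3 : u b ^ 2 - u i ^ 2 = -(u i ^ 2 - u b ^ 2) := by ring
    rw [h3]
    field_simp
    ring

/-- The second member `M` of the Lax pair: off the diagonal it is forced by the evolution of
`K ^ 2`, on the diagonal by the evolution of the vector `u = K e`, which reads `M u = - u'`. -/
lemma exists_lax_pair {u : Fin N → ℂ} (hu : ∀ i, u i ≠ 0)
    (hd : ∀ i j, i ≠ j → u i ^ 2 - u j ^ 2 ≠ 0) {L Φ : Matrix (Fin N) (Fin N) ℂ}
    (hL : ∀ i j, i ≠ j → L i j = u i * u j / (u i ^ 2 - u j ^ 2)) (hc : L * Φ = Φ * L) :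
    ∃ M : Matrix (Fin N) (Fin N) ℂ,
      (∀ i j, i ≠ j → M i j = u i ^ 2 * Φ i j / (u i ^ 2 - u j ^ 2)) ∧
      (Matrix.diagonal (fun i => u i ^ 2) * M - M * Matrix.diagonal (fun i => u i ^ 2)
        - Matrix.diagonal (fun i => u i ^ 2) * Φ = Matrix.diagonal (fun i => -(u i ^ 2 * Φ i i))) ∧
      ∀ i j, i ≠ j → (L * M - M * L) i j =
        -(u i * u j * (u i ^ 2 + u j ^ 2)) / (2 * (u i ^ 2 - u j ^ 2) ^ 2) * (Φ j j - Φ i i) := by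
  classical
  set Q : Matrix (Fin N) (Fin N) ℂ := Matrix.diagonal (fun i => u i ^ 2) with hQ
  let M : Matrix (Fin N) (Fin N) ℂ := Matrix.of fun i j => if i = j then
      Φ i i / 2 - (∑ b ∈ Finset.univ.erase i, u i ^ 2 * Φ i b / (u i ^ 2 - u b ^ 2) * u b) / u i
    else u i ^ 2 * Φ i j / (u i ^ 2 - u j ^ 2)
  have hM : ∀ i j, i ≠ j → M i j = u i ^ 2 * Φ i j / (u i ^ 2 - u j ^ 2) := fun i j h => by
    simp [M, h]
  have hMu : ∀ i, ∑ b, M i b * u b = u i * Φ i i / 2 := fun i => by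
    rw [← Finset.add_sum_erase _ _ (Finset.mem_univ i)]
    have : ∑ b ∈ Finset.univ.erase i, M i b * u b
        = ∑ b ∈ Finset.univ.erase i, u i ^ 2 * Φ i b / (u i ^ 2 - u b ^ 2) * u b :=
      Finset.sum_congr rfl fun b hb => by rw [hM i b (Finset.ne_of_mem_erase hb).symm]
    rw [this]
    have := hu i
    simp only [M, Matrix.of_apply, if_true]
    field_simp
    ring
  -- the companion identity `uᵀ (M - Φ) = u'ᵀ` follows from `[L, Φ]_jj = 0`
  have huM : ∀ j, ∑ b, u b * (M b j - Φ b j) = -(u j * Φ j j / 2) := fun j => by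
    have h0 : ∑ b, (Φ j b * L b j - L j b * Φ b j) = 0 := by
      have := congrFun (congrFun hc j) j
      simp only [Matrix.mul_apply] at this
      rw [Finset.sum_sub_distrib, this, sub_self]
    have h1 : ∑ b, (u b * (M b j - Φ b j) - M j b * u b - u j * (Φ j b * L b j - L j b * Φ b j))
        = -(u j * Φ j j) := by
      rw [← Finset.add_sum_erase _ _ (Finset.mem_univ j), Finset.sum_eq_zero, add_zero]
      swap
      · intro b hb
        have hb := Finset.ne_of_mem_erase hb
        rw [hL j b hb.symm, hL b j hb, hM j b hb.symm, hM b j hb]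
        have h1 := hd j b hb.symm
        have h3 : u b ^ 2 - u j ^ 2 = -(u j ^ 2 - u b ^ 2) := by ring
        rw [h3]
        field_simp
        ring
      ring
    rw [Finset.sum_sub_distrib, Finset.sum_sub_distrib, ← Finset.mul_sum, h0, hMu j] at h1
    linear_combination h1
  have hC : Q * M - M * Q - Q * Φ = Matrix.diagonal (fun i => -(u i ^ 2 * Φ i i)) := by
    ext i j
    rw [Matrix.sub_apply, Matrix.sub_apply, hQ, Matrix.diagonal_mul, Matrix.mul_diagonal,
      Matrix.diagonal_mul]
    by_cases h : i = j
    · subst h; simp; ring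
    · rw [hM i j h, Matrix.diagonal_apply_ne _ h]
      have := hd i j h
      field_simp
      ring
  refine ⟨M, hM, hC, fun i j hij => ?_⟩
  -- `Q L - L Q + Q` is the rank one matrix `u uᵀ`
  have hR : Q * L - L * Q + Q = Matrix.vecMulVec u u := by
    ext a b
    rw [Matrix.add_apply, Matrix.sub_apply, hQ, Matrix.diagonal_mul, Matrix.mul_diagonal,
      Matrix.vecMulVec_apply]
    by_cases h : a = b
    · subst h; simp; ring
    · rw [hL a b h, Matrix.diagonal_apply_ne _ h]
      have := hd a b h
      field_simp
      ring
  set C := Q * M - M * Q - Q * Φ with hCdef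
  have key : Q * (L * M - M * L) - (L * M - M * L) * Q
      = Matrix.vecMulVec u u * (M - Φ) - M * Matrix.vecMulVec u u - (C * L - L * C + C) := by
    have hc' : Q * (L * Φ) = Q * (Φ * L) := by rw [hc]
    have : Q * (L * M - M * L) - (L * M - M * L) * Q
      - ((Q * L - L * Q + Q) * (M - Φ) - M * (Q * L - L * Q + Q) - (C * L - L * C + C))
      = Q * (L * Φ) - Q * (Φ * L) := by
      rw [hCdef]; noncomm_ring
    rw [hc', sub_self, sub_eq_zero, hR] at this
    exact this
  have e := congrFun (congrFun key i) j
  have e1 : (Matrix.vecMulVec u u * (M - Φ)) i j = u i * -(u j * Φ j j / 2) := by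
    rw [← huM j, Matrix.mul_apply, Finset.mul_sum]
    exact Finset.sum_congr rfl fun b _ => by simp [Matrix.vecMulVec_apply]; ring
  have e2 : (M * Matrix.vecMulVec u u) i j = u i * Φ i i / 2 * u j := by
    rw [← hMu i, Matrix.mul_apply, Finset.sum_mul]
    exact Finset.sum_congr rfl fun b _ => by simp [Matrix.vecMulVec_apply]; ring
  simp only [Matrix.sub_apply (Q * _), Matrix.sub_apply (_ - _) (_ + _),
    Matrix.sub_apply (Matrix.vecMulVec u u * _), Matrix.add_apply, e1, e2] at e
  rw [hC, Matrix.sub_apply (_ * L), hQ, Matrix.diagonal_mul, Matrix.mul_diagonal,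
    Matrix.diagonal_mul, Matrix.mul_diagonal, Matrix.diagonal_apply_ne _ hij, hL i j hij] at e
  have := hd i j hij
  have e3 : (u i ^ 2 - u j ^ 2) * (L * M - M * L) i j = (u i ^ 2 - u j ^ 2) *
    (-(u i * u j * (u i ^ 2 + u j ^ 2)) / (2 * (u i ^ 2 - u j ^ 2) ^ 2) * (Φ j j - Φ i i)) := by
    have e' : (u i ^ 2 - u j ^ 2) * (L * M - M * L) i j = _ := (by ring :
      _ = u i ^ 2 * (L * M - M * L) i j - (L * M - M * L) i j * u j ^ 2).trans e
    rw [e']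
    field_simp
    ring
  exact mul_left_cancel₀ this e3

end LaxAlgebra

/-! ### The Hamiltonian vector field -/

section Derivatives

open scoped Matrix.Norms.Operator

variable {N : ℕ}

lemma hasDerivWithinAt_matrix {A : ℂ → Matrix (Fin N) (Fin N) ℂ} {A' : Matrix (Fin N) (Fin N) ℂ}
    {s : Set ℂ} {z : ℂ} :
    HasDerivWithinAt A A' s z ↔ ∀ i j, HasDerivWithinAt (fun w => A w i j) (A' i j) s z := by
  refine Iff.trans ?_ ((hasDerivWithinAt_pi (φ := A) (φ' := A')).trans
    (forall_congr' fun i => hasDerivWithinAt_pi))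
  rfl

lemma hasDerivAt_matrix {A : ℂ → Matrix (Fin N) (Fin N) ℂ} {A' : Matrix (Fin N) (Fin N) ℂ}
    {z : ℂ} : HasDerivAt A A' z ↔ ∀ i j, HasDerivAt (fun w => A w i j) (A' i j) z := by
  refine hasDerivWithinAt_univ.symm.trans (hasDerivWithinAt_matrix.trans ?_)
  simp only [hasDerivWithinAt_univ]

lemma matK_sq (x : Fin N → ℂ) :
    matK x ^ 2 = Matrix.diagonal (fun i => Complex.exp (x i / 2) ^ 2) := by
  rw [matK, Matrix.diagonal_pow]; rfl

lemma two_mul_sinh_half_sub (a b : ℂ) : 2 * Complex.sinh ((a - b) / 2) =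
    (Complex.exp (a / 2) ^ 2 - Complex.exp (b / 2) ^ 2)
      / (Complex.exp (a / 2) * Complex.exp (b / 2)) := by
  have ha := Complex.exp_ne_zero (a / 2)
  have hb := Complex.exp_ne_zero (b / 2)
  rw [Complex.two_sinh, sub_div, neg_sub, Complex.exp_sub, Complex.exp_sub]
  field_simp

lemma two_mul_cosh_half_sub (a b : ℂ) : 2 * Complex.cosh ((a - b) / 2) =
    (Complex.exp (a / 2) ^ 2 + Complex.exp (b / 2) ^ 2)
      / (Complex.exp (a / 2) * Complex.exp (b / 2)) := by
  have ha := Complex.exp_ne_zero (a / 2)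
  have hb := Complex.exp_ne_zero (b / 2)
  rw [Complex.two_cosh, sub_div, neg_sub, Complex.exp_sub, Complex.exp_sub]
  field_simp

lemma sinh_half_sub_ne_zero_iff {a b : ℂ} : Complex.sinh ((a - b) / 2) ≠ 0 ↔
    Complex.exp (a / 2) ^ 2 - Complex.exp (b / 2) ^ 2 ≠ 0 := by
  have ha := Complex.exp_ne_zero (a / 2)
  have hb := Complex.exp_ne_zero (b / 2)
  have h : Complex.sinh ((a - b) / 2) = (2 * Complex.sinh ((a - b) / 2)) / 2 := by ring
  rw [h, two_mul_sinh_half_sub]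
  simp [ha, hb]

lemma laxMatrix_apply_ne {x : Fin N → ℂ} (y : Fin N → ℂ) {i j : Fin N} (h : i ≠ j) :
    laxMatrix x y i j = Complex.exp (x i / 2) * Complex.exp (x j / 2)
      / (Complex.exp (x i / 2) ^ 2 - Complex.exp (x j / 2) ^ 2) := by
  rw [laxMatrix, Matrix.of_apply, if_neg h, two_mul_sinh_half_sub, one_div_div]

lemma hasDerivAt_one_div_two_mul_sinh {a b : ℂ} (h : Complex.sinh ((a - b) / 2) ≠ 0) :
    HasDerivAt (fun z => 1 / (2 * Complex.sinh (z / 2)))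
      (-(Complex.exp (a / 2) * Complex.exp (b / 2)
          * (Complex.exp (a / 2) ^ 2 + Complex.exp (b / 2) ^ 2))
        / (2 * (Complex.exp (a / 2) ^ 2 - Complex.exp (b / 2) ^ 2) ^ 2)) (a - b) := by
  have h1 : HasDerivAt (fun z : ℂ => 2 * Complex.sinh (z / 2))
      (2 * (Complex.cosh ((a - b) / 2) * (1 / 2))) (a - b) :=
    (((hasDerivAt_id (a - b)).div_const 2).csinh).const_mul 2
  have h2 := h1.fun_inv (mul_ne_zero two_ne_zero h)
  simp only [one_div]
  refine h2.congr_deriv ?_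
  have h3 : 2 * (Complex.cosh ((a - b) / 2) * (1 / 2)) = 2 * Complex.cosh ((a - b) / 2) / 2 := by
    ring
  have h4 := sinh_half_sub_ne_zero_iff.1 h
  have ha := Complex.exp_ne_zero (a / 2)
  have hb := Complex.exp_ne_zero (b / 2)
  rw [h3, two_mul_cosh_half_sub, two_mul_sinh_half_sub]
  field_simp

/-- The derivative of `1 / (2 sinh (z / 2))` at `z = x_i - x_j`, written in terms of
`u_i = e^{x_i/2}`. It is `0` for `i = j` because of the vanishing denominator. -/
noncomputable def laxDeriv (x : Fin N → ℂ) (i j : Fin N) : ℂ :=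
  -(Complex.exp (x i / 2) * Complex.exp (x j / 2)
      * (Complex.exp (x i / 2) ^ 2 + Complex.exp (x j / 2) ^ 2))
    / (2 * (Complex.exp (x i / 2) ^ 2 - Complex.exp (x j / 2) ^ 2) ^ 2)

lemma laxDeriv_comm (x : Fin N → ℂ) (i j : Fin N) : laxDeriv x i j = laxDeriv x j i := by
  unfold laxDeriv; congr 1 <;> ring

lemma hasDerivWithinAt_laxMatrix {x y : ℂ → Fin N → ℂ} {x' y' : Fin N → ℂ} {s : Set ℂ} {z : ℂ}
    (hcf : CollisionFree (x z)) (hx : ∀ i, HasDerivWithinAt (fun w => x w i) (x' i) s z)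
    (hy : ∀ i, HasDerivWithinAt (fun w => y w i) (y' i) s z) :
    HasDerivWithinAt (fun w => laxMatrix (x w) (y w))
      (Matrix.of fun i j => if i = j then y' i else laxDeriv (x z) i j * (x' i - x' j)) s z := by
  refine hasDerivWithinAt_matrix.2 fun i j => ?_
  by_cases h : i = j
  · subst h
    simpa [laxMatrix] using hy i
  · simp only [laxMatrix, Matrix.of_apply, if_neg h]
    exact HasDerivAt.comp_hasDerivWithinAt (h := fun w => x w i - x w j) z
      (hasDerivAt_one_div_two_mul_sinh (hcf i j h)) ((hx i).fun_sub (hx j))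

/-- The matrix `L ^ k - (L - 1) ^ k`, which generates the `k`-th flow. -/
def flowMatrix (k : ℕ+) (A : Matrix (Fin N) (Fin N) ℂ) : Matrix (Fin N) (Fin N) ℂ :=
  A ^ (k : ℕ) - (A - 1) ^ (k : ℕ)

lemma mul_flowMatrix (k : ℕ+) (A : Matrix (Fin N) (Fin N) ℂ) :
    A * flowMatrix k A = flowMatrix k A * A := by
  have h1 : Commute A ((A - 1) ^ (k : ℕ)) :=
    ((Commute.refl A).sub_right (Commute.one_right A)).pow_right _
  exact ((Commute.refl A).pow_right (k : ℕ)).sub_right h1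

lemma hasDerivAt_trace_pow {A : ℂ → Matrix (Fin N) (Fin N) ℂ} {A' : Matrix (Fin N) (Fin N) ℂ}
    {z : ℂ} (hA : HasDerivAt A A' z) (n : ℕ) :
    HasDerivAt (fun w => (A w ^ (n + 1)).trace) ((n + 1) * (A z ^ n * A').trace) z := by
  have h := hA.fun_pow' (n + 1)
  have h1 : HasDerivAt (fun w => (A w ^ (n + 1)).trace)
      (∑ i ∈ Finset.range (n + 1), A z ^ ((n + 1).pred - i) * A' * A z ^ i).trace z :=
    HasDerivAt.fun_sum fun i _ => hasDerivAt_matrix.1 h i i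
  refine h1.congr_deriv ?_
  rw [Matrix.trace_sum]
  rw [Finset.sum_congr rfl (g := fun _ => (A z ^ n * A').trace)]
  · simp
  · intro i hi
    rw [Matrix.trace_mul_cycle, ← pow_add]
    congr 3
    have := Finset.mem_range.1 hi
    simp only [Nat.pred_eq_sub_one]
    omega

lemma hasDerivAt_hamiltonian {A : ℂ → Matrix (Fin N) (Fin N) ℂ} {A' : Matrix (Fin N) (Fin N) ℂ}
    {z : ℂ} (hA : HasDerivAt A A' z) (k : ℕ+) :
    HasDerivAt (fun w => 1 / (((k : ℕ) : ℂ) + 1) *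
      ((A w - 1) ^ ((k : ℕ) + 1) - A w ^ ((k : ℕ) + 1)).trace)
      (-(flowMatrix k (A z) * A').trace) z := by
  have h := ((hasDerivAt_trace_pow (hA.sub_const 1) k).sub (hasDerivAt_trace_pow hA k)).const_mul
    (1 / (((k : ℕ) : ℂ) + 1))
  simp only [Matrix.trace_sub]
  refine h.congr_deriv ?_
  have : ((k : ℕ) : ℂ) + 1 ≠ 0 := Nat.cast_add_one_ne_zero _
  rw [flowMatrix, Matrix.sub_mul, Matrix.trace_sub]
  field_simp
  ring

lemma dHdy_eq (k : ℕ+) (i : Fin N) {x : Fin N → ℂ} (hcf : CollisionFree x) (y : Fin N → ℂ) :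
    dHdy k i x y = -flowMatrix k (laxMatrix x y) i i := by
  have h := hasDerivWithinAt_laxMatrix (s := Set.univ) (z := y i) (x := fun _ => x)
    (y := fun w => Function.update y i w) (x' := 0) (y' := Pi.single i 1) hcf
    (fun _ => hasDerivWithinAt_const _ _ _)
    (fun j => by
      have := (hasDerivAt_pi.1 (hasDerivAt_update y i (y i)) j).hasDerivWithinAt (s := Set.univ)
      simpa using this)
  replace h := h.hasDerivAt univ_mem
  have h2 := (hasDerivAt_hamiltonian h k).deriv
  simp only [Function.update_eq_self] at h2
  refine h2.trans ?_
  have : (Matrix.of fun a b => if a = b then (Pi.single i 1 : Fin N → ℂ) a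
      else laxDeriv x a b * ((0 : Fin N → ℂ) a - (0 : Fin N → ℂ) b))
      = Matrix.diagonal (Pi.single i 1) := by
    ext a b
    by_cases hab : a = b <;> simp [hab]
  rw [this]
  simp [Matrix.trace, Matrix.mul_diagonal, Pi.single_apply]

lemma dHdx_eq (k : ℕ+) (i : Fin N) {x : Fin N → ℂ} (hcf : CollisionFree x) (y : Fin N → ℂ) :
    dHdx k i x y = -∑ b, (flowMatrix k (laxMatrix x y) b i - flowMatrix k (laxMatrix x y) i b)
      * laxDeriv x i b := by
  have h := hasDerivWithinAt_laxMatrix (s := Set.univ) (z := x i)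
    (x := fun w => Function.update x i w)
    (y := fun _ => y) (x' := Pi.single i 1) (y' := 0) (by simpa using hcf)
    (fun j => by
      have := (hasDerivAt_pi.1 (hasDerivAt_update x i (x i)) j).hasDerivWithinAt (s := Set.univ)
      simpa using this)
    (fun _ => hasDerivWithinAt_const _ _ _)
  replace h := h.hasDerivAt univ_mem
  have h2 := (hasDerivAt_hamiltonian h k).deriv
  simp only [Function.update_eq_self] at h2
  refine h2.trans (congrArg Neg.neg ?_)
  set Φ := flowMatrix k (laxMatrix x y)
  have : (Matrix.of fun a b => if a = b then (0 : Fin N → ℂ) a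
      else laxDeriv x a b * ((Pi.single i 1 : Fin N → ℂ) a - (Pi.single i 1 : Fin N → ℂ) b))
      = Matrix.of fun a b =>
        laxDeriv x a b * ((Pi.single i 1 : Fin N → ℂ) a - (Pi.single i 1 : Fin N → ℂ) b) := by
    ext a b
    by_cases hab : a = b <;> simp [hab]
  rw [this]
  simp only [Matrix.trace, Matrix.diag_apply, Matrix.mul_apply, Matrix.of_apply, Pi.single_apply,
    mul_sub, sub_mul, Finset.sum_sub_distrib]
  rw [Finset.sum_comm]
  simp only [mul_ite, mul_one, mul_zero, Finset.sum_ite_eq', Finset.mem_univ, if_true,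
    Finset.sum_ite_irrel, Finset.sum_const_zero]
  simp [laxDeriv_comm x i]

end Derivatives

/-! ### Isospectral deformations -/

section Isospectral

open scoped Matrix.Norms.Operator

variable {N : ℕ}

lemma differentiable_det : Differentiable ℂ (fun A : Matrix (Fin N) (Fin N) ℂ => A.det) := by
  have h : ∀ i j, Differentiable ℂ (fun A : Matrix (Fin N) (Fin N) ℂ => A i j) := fun i j =>
    (Matrix.entryLinearMap ℂ ℂ i j).toContinuousLinearMap.differentiable
  simp only [Matrix.det_apply]
  refine Differentiable.fun_sum fun σ _ => Differentiable.const_smul ?_ _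
  exact fun A => (HasFDerivAt.finsetProd fun i _ =>
    (h (σ i) i A).hasFDerivAt).differentiableAt

lemma differentiable_exp_matrix :
    Differentiable ℂ (NormedSpace.exp : Matrix (Fin N) (Fin N) ℂ → Matrix (Fin N) (Fin N) ℂ) :=
  fun A => (NormedSpace.exp_analytic (𝕂 := ℂ) A).differentiableAt

lemma det_one_sub_smul_conj {W W' : Matrix (Fin N) (Fin N) ℂ} (h : W * W' = 1) (c : ℂ)
    (A : Matrix (Fin N) (Fin N) ℂ) : (1 - c • (W' * A * W)).det = (1 - c • A).det := by
  have h' : W' * W = 1 := mul_eq_one_comm.1 h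
  have : 1 - c • (W' * A * W) = W' * (1 - c • A) * W := by
    rw [Matrix.mul_sub, Matrix.sub_mul, Matrix.mul_one, h', Matrix.mul_smul, Matrix.smul_mul]
  rw [this, Matrix.det_mul, Matrix.det_mul, mul_right_comm, ← Matrix.det_mul, h', Matrix.det_one,
    one_mul]

/-- The determinant `det (1 - c Q e^A)` is stationary in the direction
`([Q, M] - Q B, [A, M] + B)` if `B` commutes with `A`: this is the velocity of the curve
`(e^{-εM} Q e^{-εB} e^{εM}, e^{-εM} (A + εB) e^{εM})`, along which it is constant. -/
lemma hasDerivWithinAt_det_one_sub {Q A : ℂ → Matrix (Fin N) (Fin N) ℂ}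
    {M B : Matrix (Fin N) (Fin N) ℂ} {s : Set ℂ} {z : ℂ} (c : ℂ)
    (hQ : HasDerivWithinAt Q (Q z * M - M * Q z - Q z * B) s z)
    (hA : HasDerivWithinAt A (A z * M - M * A z + B) s z) (hAB : Commute (A z) B) :
    HasDerivWithinAt (fun w => (1 - c • (Q w * NormedSpace.exp (A w))).det) 0 s z := by
  let Ψ : Matrix (Fin N) (Fin N) ℂ × Matrix (Fin N) (Fin N) ℂ → ℂ :=
    fun P => (1 - c • (P.1 * NormedSpace.exp P.2)).det
  have hΨ : Differentiable ℂ Ψ := by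
    refine differentiable_det.comp ?_
    refine (differentiable_const _).sub (Differentiable.const_smul ?_ c)
    exact differentiable_fst.mul (differentiable_exp_matrix.comp differentiable_snd)
  have hcomp := ((hΨ (Q z, A z)).hasFDerivAt).comp_hasDerivWithinAt (f := fun w => (Q w, A w)) z
    (hQ.prodMk hA)
  refine hcomp.congr_deriv ?_
  let E : Matrix (Fin N) (Fin N) ℂ → ℂ → Matrix (Fin N) (Fin N) ℂ :=
    fun C ε => NormedSpace.exp (ε • C)
  have hE : ∀ C, HasDerivAt (E C) C 0 := fun C => by
    have h : HasDerivAt (E C) _ 0 := hasDerivAt_exp_smul_const C (0 : ℂ)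
    exact h.congr_deriv (by simp)
  have hE0 : ∀ C, E C 0 = 1 := fun C => by simp [E]
  let γ : ℂ → Matrix (Fin N) (Fin N) ℂ × Matrix (Fin N) (Fin N) ℂ := fun ε =>
    (E (-M) ε * (Q z * E (-B) ε) * E M ε, E (-M) ε * (ε • B + A z) * E M ε)
  have hγ0 : γ 0 = (Q z, A z) := by simp [γ, hE0]
  have hγ : HasDerivAt γ (Q z * M - M * Q z - Q z * B, A z * M - M * A z + B) 0 := by
    have h1 := ((hE (-M)).mul (((hE (-B)).const_mul (Q z)))).mul (hE M)
    have h2 := ((hE (-M)).mul (((hasDerivAt_id (0 : ℂ)).smul_const B).add_const (A z))).mul (hE M)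
    refine (h1.prodMk h2).congr_deriv ?_
    refine Prod.ext ?_ ?_
    · simp [hE0]; noncomm_ring
    · simp [hE0]; noncomm_ring
  have hconst : ∀ ε, Ψ (γ ε) = Ψ (Q z, A z) := fun ε => by
    have hinv : E M ε * E (-M) ε = 1 := by
      simp only [E, smul_neg, Matrix.exp_neg]
      exact Matrix.mul_nonsing_inv _ ((Matrix.isUnit_iff_isUnit_det _).1 (Matrix.isUnit_exp _))
    have hconj : NormedSpace.exp (E (-M) ε * (ε • B + A z) * E M ε)
        = E (-M) ε * NormedSpace.exp (ε • B + A z) * E M ε := by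
      have := Matrix.exp_conj' (E M ε) (ε • B + A z) (Matrix.isUnit_exp _)
      have h3 : (E M ε)⁻¹ = E (-M) ε := by simp only [E, smul_neg, Matrix.exp_neg]
      rwa [h3] at this
    have hB : E (-B) ε * NormedSpace.exp (ε • B + A z) = NormedSpace.exp (A z) := by
      have h4 : Commute (ε • -B) (ε • B + A z) := by
        refine Commute.smul_left (Commute.neg_left (Commute.add_right ?_ hAB.symm)) ε
        exact (Commute.refl B).smul_right ε
      simp only [E]
      rw [← Matrix.exp_add_of_commute _ _ h4]
      congr 1
      rw [smul_neg]; abel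
    have : E (-M) ε * (Q z * E (-B) ε) * E M ε
        * (E (-M) ε * NormedSpace.exp (ε • B + A z) * E M ε)
        = E (-M) ε * (Q z * NormedSpace.exp (A z)) * E M ε := by
      calc _ = E (-M) ε * Q z * E (-B) ε * (E M ε * E (-M) ε) * NormedSpace.exp (ε • B + A z)
              * E M ε := by noncomm_ring
        _ = E (-M) ε * Q z * (E (-B) ε * NormedSpace.exp (ε • B + A z)) * E M ε := by
          rw [hinv]; noncomm_ring
        _ = _ := by rw [hB]; noncomm_ring
    simp only [Ψ, γ]
    rw [hconj, this, det_one_sub_smul_conj hinv]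
  have hΨγ := ((hΨ (γ 0)).hasFDerivAt).comp_hasDerivAt (0 : ℂ) hγ
  have hΨγ' : HasDerivAt (Ψ ∘ γ) 0 0 :=
    (hasDerivAt_const (0 : ℂ) (Ψ (Q z, A z))).congr_of_eventuallyEq
      (Eventually.of_forall hconst)
  have := hΨγ.unique hΨγ'
  rwa [hγ0] at this

open Polynomial in
lemma hasDerivWithinAt_aeval {L : ℂ → Matrix (Fin N) (Fin N) ℂ}
    {M : Matrix (Fin N) (Fin N) ℂ} {s : Set ℂ} {z : ℂ}
    (hL : HasDerivWithinAt L (L z * M - M * L z) s z) (p : ℂ[X]) :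
    HasDerivWithinAt (fun w => aeval (L w) p) (aeval (L z) p * M - M * aeval (L z) p) s z := by
  induction p using Polynomial.induction_on with
  | C a =>
    simp only [aeval_C]
    refine (hasDerivWithinAt_const _ _ _).congr_deriv ?_
    rw [Algebra.commutes, sub_self]
  | add p q hp hq =>
    simp only [map_add]
    refine (hp.add hq).congr_deriv ?_
    noncomm_ring
  | monomial n a h =>
    have e : ∀ A : Matrix (Fin N) (Fin N) ℂ, aeval A (C a * X ^ (n + 1))
        = aeval A (C a * X ^ n) * A := fun A => by simp [pow_succ, mul_assoc]
    simp only [e]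
    refine (h.mul hL).congr_deriv ?_
    noncomm_ring

open Polynomial in
lemma flowMatrix_eq_aeval (k : ℕ+) (A : Matrix (Fin N) (Fin N) ℂ) :
    flowMatrix k A = aeval A (X ^ (k : ℕ) - (X - 1) ^ (k : ℕ) : ℂ[X]) := by
  simp [flowMatrix]

/-- The Lax form of the `k`-th flow. -/
lemma exists_hasDerivWithinAt_lax {x y : ℂ → Fin N → ℂ} {s : Set ℂ} {z : ℂ} {k : ℕ+}
    (hcf : CollisionFree (x z))
    (hx : ∀ i, HasDerivWithinAt (fun w => x w i) (dHdy k i (x z) (y z)) s z)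
    (hy : ∀ i, HasDerivWithinAt (fun w => y w i) (-dHdx k i (x z) (y z)) s z) :
    ∃ M : Matrix (Fin N) (Fin N) ℂ,
      HasDerivWithinAt (fun w => matK (x w) ^ 2)
        (matK (x z) ^ 2 * M - M * matK (x z) ^ 2
          - matK (x z) ^ 2 * flowMatrix k (laxMatrix (x z) (y z))) s z ∧
      HasDerivWithinAt (fun w => laxMatrix (x w) (y w))
        (laxMatrix (x z) (y z) * M - M * laxMatrix (x z) (y z)) s z := by
  simp only [dHdy_eq k _ hcf, dHdx_eq k _ hcf, neg_neg] at hx hy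
  have hc := mul_flowMatrix k (laxMatrix (x z) (y z))
  have hL := fun i j (h : i ≠ j) => laxMatrix_apply_ne (x := x z) (y z) h
  have hd := fun i j (h : i ≠ j) => sinh_half_sub_ne_zero_iff.1 (hcf i j h)
  have hLd := hasDerivWithinAt_laxMatrix hcf hx hy
  set Φ := flowMatrix k (laxMatrix (x z) (y z))
  set L := laxMatrix (x z) (y z)
  obtain ⟨M, hM, hQM, hLM⟩ := exists_lax_pair (fun i => Complex.exp_ne_zero (x z i / 2)) hd hL hc
  refine ⟨M, ?_, hLd.congr_deriv ?_⟩
  · simp only [matK_sq]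
    rw [hQM]
    refine hasDerivWithinAt_matrix.2 fun i j => ?_
    by_cases h : i = j
    · subst h
      simp only [Matrix.diagonal_apply_eq]
      refine ((((hx i).div_const 2).cexp).fun_pow 2).congr_deriv ?_
      simp
      ring
    · simp only [Matrix.diagonal_apply_ne _ h]
      exact hasDerivWithinAt_const _ _ _
  · ext i j
    by_cases h : i = j
    · subst h
      rw [lax_commutator_diag hd hL hc hM i]
      simp [laxDeriv]
    · rw [hLM i j h]
      simp [h, laxDeriv]
      left; ring

/-- Along a segment in the `k`-th time, the spectrum of
`K² exp (p(L) - (b - s) (L^k - (L - 1)^k))` does not change. -/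
lemma det_one_sub_eq_of_segment {x y : ℂ → Fin N → ℂ} {a b : ℂ} {k : ℕ+}
    (hcf : ∀ z ∈ segment ℝ a b, CollisionFree (x z))
    (hx : ∀ z ∈ segment ℝ a b, ∀ i,
      HasDerivWithinAt (fun w => x w i) (dHdy k i (x z) (y z)) (segment ℝ a b) z)
    (hy : ∀ z ∈ segment ℝ a b, ∀ i,
      HasDerivWithinAt (fun w => y w i) (-dHdx k i (x z) (y z)) (segment ℝ a b) z)
    (c : ℂ) (p : Polynomial ℂ) :
    (1 - c • (matK (x b) ^ 2 * NormedSpace.exp (Polynomial.aeval (laxMatrix (x b) (y b)) p))).det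
      = (1 - c • (matK (x a) ^ 2 * NormedSpace.exp (Polynomial.aeval (laxMatrix (x a) (y a)) p
          - (b - a) • flowMatrix k (laxMatrix (x a) (y a))))).det := by
  set F : ℂ → ℂ := fun z => (1 - c • (matK (x z) ^ 2 *
    NormedSpace.exp (Polynomial.aeval (laxMatrix (x z) (y z)) p
          - (b - z) • flowMatrix k (laxMatrix (x z) (y z))))).det with hF
  have hderiv : ∀ z ∈ segment ℝ a b, HasDerivWithinAt F 0 (segment ℝ a b) z := by
    intro z hz
    obtain ⟨M, hQ, hL⟩ := exists_hasDerivWithinAt_lax (hcf z hz) (hx z hz) (hy z hz)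
    have h1 := hasDerivWithinAt_aeval hL p
    have h2 := hasDerivWithinAt_aeval hL
      (Polynomial.X ^ (k : ℕ) - (Polynomial.X - 1) ^ (k : ℕ) : Polynomial ℂ)
    simp only [← flowMatrix_eq_aeval] at h2
    have h3 : HasDerivWithinAt (fun w : ℂ => b - w) (-1) (segment ℝ a b) z :=
      (hasDerivWithinAt_id z _).const_sub b
    refine hasDerivWithinAt_det_one_sub c hQ ((h1.fun_sub (h3.fun_smul h2)).congr_deriv ?_) ?_
    · simp only [smul_sub, neg_smul, one_smul, Matrix.sub_mul, Matrix.mul_sub, Matrix.smul_mul,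
        Matrix.mul_smul]
      abel
    · rw [flowMatrix_eq_aeval]
      refine Commute.sub_left ?_ (Commute.smul_left (Commute.refl _) _)
      exact (Commute.all p _).map (Polynomial.aeval _)
  have := (convex_segment a b).norm_image_sub_le_of_norm_hasDerivWithin_le (C := 0) hderiv
    (by simp) (left_mem_segment ℝ a b) (right_mem_segment ℝ a b)
  rw [zero_mul, norm_le_zero_iff, sub_eq_zero] at this
  simpa [hF] using this

end Isospectral

/-! ### Diagonalization of the pair -/

section Diagonalization

variable {N : ℕ}

lemma exists_vecMulVec_of_rank_eq_one {A : Matrix (Fin N) (Fin N) ℂ} (h : A.rank = 1) :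
    ∃ v w : Fin N → ℂ, A = Matrix.vecMulVec v w := by
  obtain ⟨⟨v, hv⟩, -, hspan⟩ := finrank_eq_one_iff'.1 h
  choose w hw using fun j => hspan ⟨A.mulVecLin (Pi.single j 1), LinearMap.mem_range_self _ _⟩
  refine ⟨v, w, ?_⟩
  ext i j
  have := congrFun (congrArg Subtype.val (hw j)) i
  simp only [SetLike.mk_smul_mk, Matrix.mulVecLin_apply, Matrix.mulVec_single_one, Pi.smul_apply,
    smul_eq_mul, Matrix.col_apply] at this
  rw [Matrix.vecMulVec_apply, mul_comm, this]

/-- In a basis where `X` is diagonal, the rank one condition, multiplied by `X`, factorizes the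
entries `(d_i - d_j) W_{ij} + d_i δ_{ij}`. The diagonal entries show that no factor vanishes. -/
lemma IsTrigCMPair.exists_factors {X Z P : Matrix (Fin N) (Fin N) ℂ} (h : IsTrigCMPair X Z)
    (hP : IsUnit P) {d : Fin N → ℂ} (hd : P⁻¹ * X * P = Matrix.diagonal d) :
    ∃ v w : Fin N → ℂ, (∀ i, v i * w i = d i) ∧ (∀ i, d i ≠ 0) ∧
      ∀ i j, i ≠ j → (d i - d j) * (P⁻¹ * Z * P) i j = v i * w j := by
  have hPd : IsUnit P.det := (Matrix.isUnit_iff_isUnit_det _).1 hP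
  have hXd : IsUnit X.det := (Matrix.isUnit_iff_isUnit_det _).1 h.isUnit
  have hPi : P * P⁻¹ = 1 := Matrix.mul_nonsing_inv _ hPd
  set W := P⁻¹ * Z * P with hW
  have e : P⁻¹ * ((X * Z * X⁻¹ - Z + 1) * X) * P
      = Matrix.diagonal d * W - W * Matrix.diagonal d + Matrix.diagonal d := by
    have hX : X⁻¹ * X = 1 := Matrix.nonsing_inv_mul _ hXd
    have e1 : (X * Z * X⁻¹ - Z + 1) * X = X * Z - Z * X + X := by
      rw [add_mul, sub_mul, mul_assoc (X * Z), hX]; simp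
    have e2 : P⁻¹ * X * P * (P⁻¹ * Z * P) = P⁻¹ * (X * Z) * P := by
      rw [show P⁻¹ * X * P * (P⁻¹ * Z * P) = P⁻¹ * X * (P * P⁻¹) * Z * P by noncomm_ring, hPi]
      noncomm_ring
    have e3 : P⁻¹ * Z * P * (P⁻¹ * X * P) = P⁻¹ * (Z * X) * P := by
      rw [show P⁻¹ * Z * P * (P⁻¹ * X * P) = P⁻¹ * Z * (P * P⁻¹) * X * P by noncomm_ring, hPi]
      noncomm_ring
    rw [e1, ← hd, hW, e2, e3]
    noncomm_ring
  have hr : (Matrix.diagonal d * W - W * Matrix.diagonal d + Matrix.diagonal d).rank = 1 := by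
    rw [← e, Matrix.rank_mul_eq_left_of_isUnit_det _ _ hPd,
      Matrix.rank_mul_eq_right_of_isUnit_det _ _ (Matrix.isUnit_nonsing_inv_det _ hPd),
      Matrix.rank_mul_eq_left_of_isUnit_det _ _ hXd, h.rank_eq_one]
  obtain ⟨v, w, hvw⟩ := exists_vecMulVec_of_rank_eq_one hr
  have hij := fun i j => congrFun (congrFun hvw i) j
  simp only [Matrix.add_apply, Matrix.sub_apply, Matrix.diagonal_mul, Matrix.mul_diagonal,
    Matrix.vecMulVec_apply] at hij
  refine ⟨v, w, fun i => ?_, ?_, fun i j hne => ?_⟩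
  · rw [← hij i i, Matrix.diagonal_apply_eq]; ring
  · have hdet : (Matrix.diagonal d).det ≠ 0 := by
      rw [← hd, Matrix.det_mul, Matrix.det_mul]
      exact mul_ne_zero (mul_ne_zero (Matrix.isUnit_nonsing_inv_det _ hPd).ne_zero hXd.ne_zero)
        hPd.ne_zero
    rw [Matrix.det_diagonal] at hdet
    exact fun i => Finset.prod_ne_zero_iff.1 hdet i (Finset.mem_univ i)
  · rw [← hij i j, Matrix.diagonal_apply_ne _ hne]; ring

lemma IsTrigCMPair.sub_ne_zero {X Z P : Matrix (Fin N) (Fin N) ℂ} (h : IsTrigCMPair X Z)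
    (hP : IsUnit P) {d : Fin N → ℂ} (hd : P⁻¹ * X * P = Matrix.diagonal d) {i j : Fin N}
    (hij : i ≠ j) : d i - d j ≠ 0 := by
  obtain ⟨v, w, hvw, hd0, hW⟩ := h.exists_factors hP hd
  intro h0
  have h1 := hW i j hij
  rw [h0, zero_mul] at h1
  rcases mul_eq_zero.1 h1.symm with h2 | h2
  · exact hd0 i (by rw [← hvw i, h2, zero_mul])
  · exact hd0 j (by rw [← hvw j, h2, mul_zero])

lemma IsDiagonalizingData.collisionFree {X Z U : Matrix (Fin N) (Fin N) ℂ} {x₀ y₀ : Fin N → ℂ}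
    (h : IsTrigCMPair X Z) (hU : IsDiagonalizingData X Z U x₀ y₀) : CollisionFree x₀ :=
  fun _ _ hij => sinh_half_sub_ne_zero_iff.2
    (h.sub_ne_zero hU.isUnit (hU.conj_X.trans (matK_sq x₀)) hij)

lemma IsTrigCMPair.exists_diagonalizingData {X Z : Matrix (Fin N) (Fin N) ℂ}
    (h : IsTrigCMPair X Z) (hX : MatrixDiagonalizable X) :
    ∃ (U : Matrix (Fin N) (Fin N) ℂ) (x₀ y₀ : Fin N → ℂ), IsDiagonalizingData X Z U x₀ y₀ := by
  obtain ⟨P, d, hP, hd⟩ := hX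
  obtain ⟨v, w, hvw, hd0, hW⟩ := h.exists_factors hP hd
  set W := P⁻¹ * Z * P with hWdef
  let x₀ : Fin N → ℂ := fun i => Complex.log (d i)
  let u : Fin N → ℂ := fun i => Complex.exp (x₀ i / 2)
  have hu : ∀ i, u i ≠ 0 := fun i => Complex.exp_ne_zero _
  have hu2 : ∀ i, u i ^ 2 = d i := fun i => by
    simp only [u, x₀]
    rw [← Complex.exp_nat_mul, Nat.cast_ofNat, mul_div_cancel₀ _ two_ne_zero,
      Complex.exp_log (hd0 i)]
  have hv : ∀ i, v i ≠ 0 := fun i h0 => hd0 i (by rw [← hvw i, h0, zero_mul])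
  -- the scaling of the eigenvectors that turns both factors into `e^{x_i/2}`
  let g : Fin N → ℂ := fun i => v i / u i
  have hg : ∀ i, g i ≠ 0 := fun i => div_ne_zero (hv i) (hu i)
  have hGinv : (Matrix.diagonal g)⁻¹ = Matrix.diagonal fun i => (g i)⁻¹ := by
    refine Matrix.inv_eq_left_inv ?_
    rw [Matrix.diagonal_mul_diagonal]
    simp [hg]
  have hGu : IsUnit (Matrix.diagonal g) := by
    rw [Matrix.isUnit_iff_isUnit_det, Matrix.det_diagonal, isUnit_iff_ne_zero]
    exact Finset.prod_ne_zero_iff.2 fun i _ => hg i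
  have hconj : ∀ A : Matrix (Fin N) (Fin N) ℂ, (P * Matrix.diagonal g)⁻¹ * A
      * (P * Matrix.diagonal g) = Matrix.diagonal (fun i => (g i)⁻¹) * (P⁻¹ * A * P)
        * Matrix.diagonal g := fun A => by
    rw [Matrix.mul_inv_rev, hGinv]; noncomm_ring
  refine ⟨P * Matrix.diagonal g, x₀, fun i => W i i, hP.mul hGu, ?_, ?_⟩
  · rw [hconj, hd, matK_sq, Matrix.diagonal_mul_diagonal, Matrix.diagonal_mul_diagonal]
    congr 1
    ext i
    rw [mul_comm (g i)⁻¹, mul_assoc, inv_mul_cancel₀ (hg i), mul_one]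
    exact (hu2 i).symm
  · rw [hconj, ← hWdef]
    ext i j
    rw [Matrix.mul_diagonal, Matrix.diagonal_mul]
    by_cases hij : i = j
    · subst hij
      rw [mul_comm (g i)⁻¹, mul_assoc, inv_mul_cancel₀ (hg i), mul_one]
      simp [laxMatrix]
    · rw [laxMatrix_apply_ne _ hij]
      have hne : d i - d j ≠ 0 := h.sub_ne_zero hP hd hij
      change (g i)⁻¹ * W i j * g j = u i * u j / (u i ^ 2 - u j ^ 2)
      rw [hu2, hu2, eq_div_iff hne]
      have h1 := hW i j hij
      have h2 := hvw j
      rw [← hu2] at h2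
      have := hu i
      have := hu j
      have := hv i
      have := hv j
      simp only [g]
      rw [show (v i / u i)⁻¹ * W i j * (v j / u j) * (d i - d j)
        = (v i / u i)⁻¹ * ((d i - d j) * W i j) * (v j / u j) by ring, h1]
      field_simp
      linear_combination (1) * h2

end Diagonalization

/-! ### The determinant along a solution -/

section TauFunction

open scoped Matrix.Norms.Operator

variable {N : ℕ}

/-- The exponent `∑ t_k (Z^k - (Z - 1)^k)`. -/
noncomputable def timeSum (Z : Matrix (Fin N) (Fin N) ℂ) (t : ℕ+ → ℂ) :
    Matrix (Fin N) (Fin N) ℂ := ∑' k : ℕ+, t k • flowMatrix k Z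

lemma hasSum_update_smul {F : ℕ+ → Matrix (Fin N) (Fin N) ℂ} {t : ℕ+ → ℂ}
    (h : Summable fun k => t k • F k) (k : ℕ+) (b : ℂ) :
    HasSum (fun j => Function.update t k b j • F j) ((∑' j, t j • F j) + (b - t k) • F k) := by
  have h1 := h.hasSum.update k (b • F k)
  have e : Function.update (fun j => t j • F j) k (b • F k)
      = fun j => Function.update t k b j • F j := by
    ext1 j
    by_cases hj : j = k
    · subst hj; simp
    · simp [hj]
  rw [e] at h1
  have e2 : b • F k - t k • F k + ∑' j, t j • F j = (∑' j, t j • F j) + (b - t k) • F k := by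
    rw [sub_smul]; abel
  exact e2 ▸ h1

lemma timeSum_update {Z : Matrix (Fin N) (Fin N) ℂ} {t : ℕ+ → ℂ}
    (h : Summable fun k : ℕ+ => t k • flowMatrix k Z) (k : ℕ+) (b : ℂ) :
    timeSum Z (Function.update t k b) = timeSum Z t + (b - t k) • flowMatrix k Z :=
  (hasSum_update_smul h k b).tsum_eq

lemma tendsto_timeSum_truncTimes {Z : Matrix (Fin N) (Fin N) ℂ} {t : ℕ+ → ℂ}
    (h : Summable fun k : ℕ+ => t k • flowMatrix k Z) :
    Tendsto (fun m => timeSum Z (truncTimes m t)) atTop (𝓝 (timeSum Z t)) := by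
  let F : ℕ → Finset ℕ+ := fun m => (Finset.range m).image Nat.succPNat
  have hF : ∀ m (k : ℕ+), k ∈ F m ↔ (k : ℕ) ≤ m := fun m k => by
    simp only [F, Finset.mem_image, Finset.mem_range]
    constructor
    · rintro ⟨a, ha, rfl⟩
      exact ha
    · intro hk
      exact ⟨k.natPred, by have := k.natPred_add_one; omega, PNat.succPNat_natPred k⟩
  have hlim : Tendsto F atTop atTop := by
    refine tendsto_atTop_finset_of_monotone (fun m n hmn k hk => ?_) fun k => ⟨k, ?_⟩
    · exact (hF n k).2 (((hF m k).1 hk).trans hmn)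
    · exact (hF k k).2 le_rfl
  have h1 := h.hasSum.comp hlim
  refine h1.congr fun m => ?_
  rw [timeSum, tsum_eq_sum (s := F m)]
  · refine Finset.sum_congr rfl fun k hk => ?_
    rw [truncTimes, if_pos ((hF m k).1 hk)]
  · intro k hk
    rw [truncTimes, if_neg (fun h => hk ((hF m k).2 h)), zero_smul]

lemma aeval_conj {U : Matrix (Fin N) (Fin N) ℂ} (hU : IsUnit U) (Z : Matrix (Fin N) (Fin N) ℂ)
    (p : Polynomial ℂ) : Polynomial.aeval (U⁻¹ * Z * U) p = U⁻¹ * Polynomial.aeval Z p * U := by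
  have hd := (Matrix.isUnit_iff_isUnit_det _).1 hU
  have h1 : U⁻¹ * U = 1 := Matrix.nonsing_inv_mul _ hd
  have h2 : U * U⁻¹ = 1 := Matrix.mul_nonsing_inv _ hd
  induction p using Polynomial.induction_on with
  | C a =>
    rw [Polynomial.aeval_C, Polynomial.aeval_C, ← Algebra.commutes, mul_assoc, h1, mul_one]
  | add p q hp hq => rw [map_add, map_add, hp, hq]; noncomm_ring
  | monomial n a h =>
    have e : ∀ A : Matrix (Fin N) (Fin N) ℂ, Polynomial.aeval A
        (Polynomial.C a * Polynomial.X ^ (n + 1))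
        = Polynomial.aeval A (Polynomial.C a * Polynomial.X ^ n) * A := fun A => by
      simp [pow_succ, mul_assoc]
    rw [e, e, h]
    calc _ = U⁻¹ * Polynomial.aeval Z (Polynomial.C a * Polynomial.X ^ n) * (U * U⁻¹) * Z * U := by
          noncomm_ring
      _ = _ := by rw [h2]; noncomm_ring

/-- Along every chain of moves in `Ω` the spectrum of `K² exp p(L)` evolves explicitly. Allowing an
arbitrary polynomial `p` makes the statement inductive: a move in `t_k` shifts `p`. -/
lemma det_one_sub_eq_of_reach {X Z U : Matrix (Fin N) (Fin N) ℂ} {x₀ y₀ : Fin N → ℂ}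
    (hU : IsDiagonalizingData X Z U x₀ y₀) {Ω : Set (ℕ+ → ℂ)} {x y : (ℕ+ → ℂ) → Fin N → ℂ}
    (hsol : IsTrigCMSolution x₀ y₀ Ω x y) {t : ℕ+ → ℂ}
    (ht : Relation.ReflTransGen (TimeStep Ω) 0 t) :
    (Summable fun k : ℕ+ => t k • flowMatrix k Z) ∧ ∀ (p : Polynomial ℂ) (c : ℂ),
      (1 - c • (matK (x t) ^ 2 *
        NormedSpace.exp (Polynomial.aeval (laxMatrix (x t) (y t)) p))).det
      = (1 - c • (X * NormedSpace.exp (Polynomial.aeval Z p - timeSum Z t))).det := by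
  induction ht with
  | refl =>
    refine ⟨by simp, fun p c => ?_⟩
    have h2 : U * U⁻¹ = 1 :=
      Matrix.mul_nonsing_inv _ ((Matrix.isUnit_iff_isUnit_det _).1 hU.isUnit)
    have h0 : timeSum Z 0 = 0 := by simp [timeSum]
    rw [hsol.init_x, hsol.init_y, ← hU.conj_X, ← hU.conj_Z, aeval_conj hU.isUnit,
      Matrix.exp_conj' _ _ hU.isUnit, h0, sub_zero]
    rw [show U⁻¹ * X * U * (U⁻¹ * NormedSpace.exp (Polynomial.aeval Z p) * U)
      = U⁻¹ * (X * (U * U⁻¹) * NormedSpace.exp (Polynomial.aeval Z p)) * U by noncomm_ring,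
      h2, mul_one, det_one_sub_smul_conj h2]
  | @tail t t' _ hstep ih =>
    obtain ⟨k, b, rfl, hseg⟩ := hstep
    obtain ⟨hs, ih⟩ := ih
    refine ⟨(hasSum_update_smul hs k b).summable, fun p c => ?_⟩
    have key := det_one_sub_eq_of_segment (x := fun s => x (Function.update t k s))
      (y := fun s => y (Function.update t k s)) (a := t k) (b := b) (k := k)
      (fun z hz => hsol.collisionFree _ (hseg z hz))
      (fun z hz i => by
        have := hsol.flow_x _ (hseg z hz) k i
        simp only [Function.update_idem, Function.update_self] at this
        exact this.mono hseg)
      (fun z hz i => by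
        have := hsol.flow_y _ (hseg z hz) k i
        simp only [Function.update_idem, Function.update_self] at this
        exact this.mono hseg) c p
    simp only [Function.update_eq_self] at key
    rw [key]
    have e : ∀ A : Matrix (Fin N) (Fin N) ℂ,
        Polynomial.aeval A p - (b - t k) • flowMatrix k A = Polynomial.aeval A
          (p - (b - t k) • (Polynomial.X ^ (k : ℕ) - (Polynomial.X - 1) ^ (k : ℕ))) := fun A => by
      rw [map_sub, map_smul, ← flowMatrix_eq_aeval]
    rw [e, ih, ← e, timeSum_update hs]
    congr 5
    abel

lemma hasSum_flowMatrix_of_timesConverge {Z : Matrix (Fin N) (Fin N) ℂ} {t : ℕ+ → ℂ}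
    (h : TimesConverge Z t) : HasSum (fun k : ℕ+ => t k • flowMatrix k Z)
      ((∑' k : ℕ+, t k • Z ^ (k : ℕ)) - ∑' k : ℕ+, t k • (Z - 1) ^ (k : ℕ)) := by
  simpa [flowMatrix, smul_sub] using h.1.hasSum.sub h.2.hasSum

lemma tauDet_shiftFirst {X Z : Matrix (Fin N) (Fin N) ℂ} {t : ℕ+ → ℂ} (h : TimesConverge Z t)
    (ξ : ℂ) : tauDet X (Z - 1) Z (shiftFirst ξ t)
      = (1 - Complex.exp (-ξ) • (X * NormedSpace.exp (-timeSum Z t))).det := by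
  have hZ := (hasSum_update_smul h.1 1 (ξ + t 1)).tsum_eq
  have hY := (hasSum_update_smul h.2 1 (ξ + t 1)).tsum_eq
  simp only [PNat.one_coe, pow_one, add_sub_cancel_right] at hZ hY
  rw [tauDet, shiftFirst, hZ, hY, mul_assoc, timeSum, (hasSum_flowMatrix_of_timesConverge h).tsum_eq]
  set A := ∑' k : ℕ+, t k • Z ^ (k : ℕ) with hA
  set B := ∑' k : ℕ+, t k • (Z - 1) ^ (k : ℕ) with hB
  have hZ1 : Commute Z (Z - 1) := (Commute.refl Z).sub_right (Commute.one_right Z)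
  have hAC : ∀ C, Commute C Z → Commute C A := fun C hC =>
    Commute.tsum_right _ fun k => (hC.pow_right _).smul_right _
  have hBC : ∀ C, Commute C (Z - 1) → Commute C B := fun C hC =>
    Commute.tsum_right _ fun k => (hC.pow_right _).smul_right _
  have hAB : Commute A B := hBC A (hAC _ hZ1.symm).symm
  have hc : Commute (-(A + ξ • Z)) (B + ξ • (Z - 1)) := by
    refine Commute.neg_left (Commute.add_left (hAB.add_right ?_) ?_)
    · exact ((hAC _ hZ1.symm).symm).smul_right ξ
    · exact ((hBC _ hZ1).add_right (hZ1.smul_right ξ)).smul_left ξ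
  rw [← Matrix.exp_add_of_commute _ _ hc]
  have e : -(A + ξ • Z) + (B + ξ • (Z - 1)) = algebraMap ℂ _ (-ξ) + -(A - B) := by
    rw [Algebra.algebraMap_eq_smul_one, smul_sub, neg_smul]; abel
  have hs : NormedSpace.exp (algebraMap ℂ (Matrix (Fin N) (Fin N) ℂ) (-ξ))
      = algebraMap ℂ _ (Complex.exp (-ξ)) := by
    rw [Complex.exp_eq_exp_ℂ]
    exact (NormedSpace.algebraMap_exp_comm (-ξ)).symm
  rw [e, Matrix.exp_add_of_commute _ _ (Algebra.commute_algebraMap_left _ _), hs,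
    ← Algebra.smul_def, Matrix.mul_smul]

lemma det_one_sub_matK_sq (ξ : ℂ) (x : Fin N → ℂ) :
    (1 - Complex.exp (-ξ) • matK x ^ 2).det =
      Complex.exp (∑ i, (x i - ξ) / 2) * ∏ i, (2 * Complex.sinh ((ξ - x i) / 2)) := by
  rw [matK_sq, ← Matrix.diagonal_one, ← Matrix.diagonal_smul, Matrix.diagonal_sub,
    Matrix.det_diagonal, Complex.exp_sum, ← Finset.prod_mul_distrib]
  refine Finset.prod_congr rfl fun i _ => ?_
  rw [Complex.two_sinh, mul_sub, ← Complex.exp_add, ← Complex.exp_add, Pi.smul_apply, smul_eq_mul,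
    ← Complex.exp_nat_mul, ← Complex.exp_add]
  congr 1
  · rw [show (x i - ξ) / 2 + (ξ - x i) / 2 = 0 by ring, Complex.exp_zero]
  · congr 1; push_cast; ring

lemma IsTrigCMSolution.tauDet_eq {X Z U : Matrix (Fin N) (Fin N) ℂ} {x₀ y₀ : Fin N → ℂ}
    (hU : IsDiagonalizingData X Z U x₀ y₀) {Ω : Set (ℕ+ → ℂ)} {x y : (ℕ+ → ℂ) → Fin N → ℂ}
    (hsol : IsTrigCMSolution x₀ y₀ Ω x y) {t : ℕ+ → ℂ} (ht : t ∈ Ω) (hc : TimesConverge Z t)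
    (ξ : ℂ) : tauDet X (Z - 1) Z (shiftFirst ξ t) =
      Complex.exp (∑ i, (x t i - ξ) / 2) * ∏ i, (2 * Complex.sinh ((ξ - x t i) / 2)) := by
  rw [tauDet_shiftFirst hc, ← det_one_sub_matK_sq]
  set c := Complex.exp (-ξ)
  have hdet : Continuous fun A : Matrix (Fin N) (Fin N) ℂ => A.det := continuous_id.matrix_det
  have h1 : Tendsto (fun m => (1 - c • matK (x (truncTimes m t)) ^ 2).det) atTop
      (𝓝 (1 - c • matK (x t) ^ 2).det) := by
    have hK : Continuous fun x : Fin N → ℂ => (1 - c • matK x ^ 2).det := by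
      simp only [matK_sq]
      refine hdet.comp (continuous_const.sub (Continuous.const_smul ?_ c))
      exact Continuous.matrix_diagonal (by fun_prop)
    exact (hK.tendsto _).comp (hsol.tendsto_x t ht)
  have h2 : Tendsto (fun m => (1 - c • (X * NormedSpace.exp (-timeSum Z (truncTimes m t)))).det)
      atTop (𝓝 (1 - c • (X * NormedSpace.exp (-timeSum Z t))).det) := by
    have hK : Continuous fun S : Matrix (Fin N) (Fin N) ℂ =>
        (1 - c • (X * NormedSpace.exp (-S))).det := by
      refine hdet.comp (continuous_const.sub (Continuous.const_smul ?_ c))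
      exact continuous_const.mul (differentiable_exp_matrix.continuous.comp continuous_neg)
    exact (hK.tendsto _).comp
      (tendsto_timeSum_truncTimes (hasSum_flowMatrix_of_timesConverge hc).summable)
  refine tendsto_nhds_unique (h2.congr' ?_) h1
  filter_upwards [hsol.domain.reach t ht] with m hm
  have := (det_one_sub_eq_of_reach hU hsol hm).2 0 c
  simpa using this.symm

end TauFunction

/-! ### Local existence -/

section Existence

open scoped Matrix.Norms.Operator

variable {N : ℕ}

/-- The vector `u = K(x) e`, with entries `e^{x_i/2}`. -/
noncomputable def expHalf (x : Fin N → ℂ) : Fin N → ℂ := fun i => Complex.exp (x i / 2)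

/-- The equations of a diagonalization `A = V K(x)² V⁻¹`, in which the scaling of the eigenvectors
is fixed by `V K(x) e = u`. -/
noncomputable def diagEquation (u : Fin N → ℂ)
    (P : Matrix (Fin N) (Fin N) ℂ × ((Fin N → ℂ) × Matrix (Fin N) (Fin N) ℂ)) :
    Matrix (Fin N) (Fin N) ℂ × (Fin N → ℂ) :=
  (P.2.2 * Matrix.diagonal (fun i => Complex.exp (P.2.1 i / 2) ^ 2) - P.1 * P.2.2,
    fun i => ∑ j, P.2.2 i j * Complex.exp (P.2.1 j / 2) - u i)

lemma contDiff_diagEquation (u : Fin N → ℂ) : ContDiff ℂ 1 (diagEquation u) := by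
  have hx : ∀ j, ContDiff ℂ 1
      fun P : Matrix (Fin N) (Fin N) ℂ × ((Fin N → ℂ) × Matrix (Fin N) (Fin N) ℂ) => P.2.1 j :=
    fun j => (contDiff_apply ℂ ℂ j).comp (contDiff_fst.comp contDiff_snd)
  have hexp : ∀ j, ContDiff ℂ 1
      fun P : Matrix (Fin N) (Fin N) ℂ × ((Fin N → ℂ) × Matrix (Fin N) (Fin N) ℂ) =>
        Complex.exp (P.2.1 j / 2) := fun j => ((hx j).div_const 2).cexp
  have hV : ContDiff ℂ 1
      fun P : Matrix (Fin N) (Fin N) ℂ × ((Fin N → ℂ) × Matrix (Fin N) (Fin N) ℂ) => P.2.2 :=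
    contDiff_snd.comp contDiff_snd
  refine ContDiff.prodMk ?_ (contDiff_pi.2 fun i => ?_)
  · refine (hV.mul ?_).sub (contDiff_fst.mul hV)
    exact (Matrix.diagonalLinearMap (Fin N) ℂ ℂ).toContinuousLinearMap.contDiff.comp
      (contDiff_pi.2 fun j => (hexp j).pow 2)
  · refine (ContDiff.sum fun j _ => ContDiff.mul ?_ (hexp j)).sub contDiff_const
    exact (Matrix.entryLinearMap ℂ ℂ i j).toContinuousLinearMap.contDiff.comp hV

/-- The linearization of the diagonalization equations at a diagonal matrix with distinct
eigenvalues is injective in the unknowns: the first equation determines the eigenvalues and the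
off-diagonal part of `V`, the second one its diagonal part. -/
lemma eq_zero_of_fderiv_diagEquation {x₀ : Fin N → ℂ} (h : CollisionFree x₀)
    {a : Fin N → ℂ} {W : Matrix (Fin N) (Fin N) ℂ}
    (h0 : fderiv ℂ (diagEquation (expHalf x₀)) (matK x₀ ^ 2, (x₀, 1)) (0, (a, W)) = 0) :
    a = 0 ∧ W = 0 := by
  have hd := fun i j (hij : i ≠ j) => sinh_half_sub_ne_zero_iff.1 (h i j hij)
  let γ : ℂ → Matrix (Fin N) (Fin N) ℂ × ((Fin N → ℂ) × Matrix (Fin N) (Fin N) ℂ) :=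
    fun ε => (matK x₀ ^ 2, (fun i => x₀ i + ε * a i, 1 + ε • W))
  have hγ0 : γ 0 = (matK x₀ ^ 2, (x₀, 1)) := by simp [γ]
  have hx : ∀ i, HasDerivAt (fun ε : ℂ => x₀ i + ε * a i) (a i) 0 := fun i => by
    simpa using ((hasDerivAt_id (0 : ℂ)).mul_const (a i)).const_add (x₀ i)
  have hW : HasDerivAt (fun ε : ℂ => 1 + ε • W) W 0 := by
    have hW : HasDerivAt (fun ε : ℂ => 1 + ε • W) _ 0 :=
      ((hasDerivAt_id (0 : ℂ)).smul_const W).const_add 1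
    exact hW.congr_deriv (one_smul _ _)
  have hγ : HasDerivAt γ (0, (a, W)) 0 :=
    (hasDerivAt_const _ _).prodMk ((hasDerivAt_pi.2 hx).prodMk hW)
  have hdiff := (contDiff_diagEquation (expHalf x₀)).differentiable one_ne_zero
  have h1 := ((hdiff (γ 0)).hasFDerivAt).comp_hasDerivAt (0 : ℂ) hγ
  rw [hγ0] at h1
  replace h1 := h1.congr_deriv h0
  have hexp : ∀ i, HasDerivAt (fun ε : ℂ => Complex.exp ((x₀ i + ε * a i) / 2))
      (Complex.exp (x₀ i / 2) * (a i / 2)) 0 := fun i => by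
    simpa using ((hx i).div_const 2).cexp
  have hWij := hasDerivAt_matrix.1 hW
  have hfst : ∀ i j, W i j * Complex.exp (x₀ j / 2) ^ 2
      + (1 : Matrix (Fin N) (Fin N) ℂ) i j * (Complex.exp (x₀ j / 2) ^ 2 * a j)
      - Complex.exp (x₀ i / 2) ^ 2 * W i j = 0 := by
    intro i j
    have h2 := hasDerivAt_matrix.1 (h1.fst) i j
    have e : (fun ε => ((diagEquation (expHalf x₀) ∘ γ) ε).1 i j) = fun ε : ℂ =>
        (1 + ε • W) i j * Complex.exp ((x₀ j + ε * a j) / 2) ^ 2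
          - Complex.exp (x₀ i / 2) ^ 2 * (1 + ε • W) i j := by
      ext ε
      simp only [Function.comp_apply, diagEquation, γ, matK_sq]
      rw [Matrix.sub_apply, Matrix.mul_diagonal, Matrix.diagonal_mul]
    rw [e] at h2
    have h3 := ((hWij i j).fun_mul ((hexp j).fun_pow 2)).fun_sub
      ((hWij i j).const_mul (Complex.exp (x₀ i / 2) ^ 2))
    have h4 := h3.unique h2
    simp only [zero_mul, add_zero, zero_smul, Matrix.zero_apply, Prod.fst_zero] at h4
    rw [← h4]
    ring
  have hoff : ∀ i j, i ≠ j → W i j = 0 := fun i j hij => by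
    have h2 := hfst i j
    rw [Matrix.one_apply_ne hij] at h2
    refine (mul_eq_zero.1 (?_ : (Complex.exp (x₀ i / 2) ^ 2 - Complex.exp (x₀ j / 2) ^ 2) * W i j
      = 0)).resolve_left (hd i j hij)
    linear_combination -h2
  have ha : ∀ i, a i = 0 := fun i => by
    have h2 := hfst i i
    rw [Matrix.one_apply_eq] at h2
    refine (mul_eq_zero.1 (?_ : Complex.exp (x₀ i / 2) ^ 2 * a i = 0)).resolve_left
      (pow_ne_zero _ (Complex.exp_ne_zero _))
    linear_combination h2
  have hsnd : ∀ i, ∑ j, W i j * Complex.exp (x₀ j / 2) = 0 := by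
    intro i
    have h2 := hasDerivAt_pi.1 (h1.snd) i
    have h3 := (HasDerivAt.fun_sum fun j (_ : j ∈ Finset.univ) =>
      (hWij i j).fun_mul (hexp j)).sub_const (expHalf x₀ i)
    have h4 := h3.unique h2
    simpa [ha] using h4
  refine ⟨funext ha, ?_⟩
  ext i j
  by_cases hij : i = j
  · subst hij
    have h2 := hsnd i
    rw [Finset.sum_eq_single i (fun j _ hj => by rw [hoff i j hj.symm, zero_mul]) (by simp)] at h2
    exact (mul_eq_zero.1 h2).resolve_right (Complex.exp_ne_zero _)
  · exact hoff i j hij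

/-- Near a diagonal matrix with distinct eigenvalues, diagonalizations depend holomorphically on
the matrix. -/
lemma exists_local_diagonalization {x₀ : Fin N → ℂ} (h : CollisionFree x₀) :
    ∃ (ξ : Matrix (Fin N) (Fin N) ℂ → Fin N → ℂ)
      (V : Matrix (Fin N) (Fin N) ℂ → Matrix (Fin N) (Fin N) ℂ),
      ξ (matK x₀ ^ 2) = x₀ ∧ V (matK x₀ ^ 2) = 1 ∧ ∀ᶠ A in 𝓝 (matK x₀ ^ 2),
        DifferentiableAt ℂ ξ A ∧ DifferentiableAt ℂ V A ∧ V A * matK (ξ A) ^ 2 = A * V A ∧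
        (V A).mulVec (expHalf (ξ A)) = expHalf x₀ ∧ IsUnit (V A) ∧ CollisionFree (ξ A) := by
  set u := expHalf x₀ with hu
  have hcd := (contDiff_diagEquation u).contDiffAt (x := (matK x₀ ^ 2, (x₀, 1)))
  have hinv : (fderiv ℂ (diagEquation u) (matK x₀ ^ 2, (x₀, 1)) ∘L
      .inr ℂ (Matrix (Fin N) (Fin N) ℂ) ((Fin N → ℂ) × Matrix (Fin N) (Fin N) ℂ)).IsInvertible := by
    set D := fderiv ℂ (diagEquation u) (matK x₀ ^ 2, (x₀, 1)) ∘L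
      .inr ℂ (Matrix (Fin N) (Fin N) ℂ) ((Fin N → ℂ) × Matrix (Fin N) (Fin N) ℂ) with hD
    have hinj : Function.Injective D.toLinearMap := by
      refine (injective_iff_map_eq_zero _).2 fun P hP => ?_
      obtain ⟨a, W⟩ := P
      obtain ⟨h1, h2⟩ := eq_zero_of_fderiv_diagEquation h (a := a) (W := W) hP
      rw [h1, h2]; rfl
    have hfr : Module.finrank ℂ ((Fin N → ℂ) × Matrix (Fin N) (Fin N) ℂ)
        = Module.finrank ℂ (Matrix (Fin N) (Fin N) ℂ × (Fin N → ℂ)) := by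
      rw [Module.finrank_prod, Module.finrank_prod, add_comm]
    exact ⟨(LinearEquiv.ofInjectiveOfFinrankEq _ hinj hfr).toContinuousLinearEquiv,
      ContinuousLinearMap.ext fun _ => rfl⟩
  set ψ := hcd.implicitFunction one_ne_zero hinv with hψ
  have hψ0 : ψ (matK x₀ ^ 2) = (x₀, 1) := hcd.implicitFunction_apply_self one_ne_zero hinv
  have hψd : ContDiffAt ℂ 1 ψ (matK x₀ ^ 2) := hcd.contDiffAt_implicitFunction one_ne_zero hinv
  have hψe := hcd.eventually_apply_implicitFunction one_ne_zero hinv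
  have hbase : diagEquation u (matK x₀ ^ 2, (x₀, 1)) = 0 := by
    refine Prod.ext ?_ ?_
    · simp [diagEquation, matK_sq]
    · ext i
      simp [diagEquation, Matrix.one_apply, hu, expHalf]
  rw [hbase] at hψe
  have hcont : ContinuousAt ψ (matK x₀ ^ 2) := hψd.continuousAt
  refine ⟨fun A => (ψ A).1, fun A => (ψ A).2, by simp [hψ0], by simp [hψ0], ?_⟩
  have hunit : ∀ᶠ A in 𝓝 (matK x₀ ^ 2), (ψ A).2.det ≠ 0 := by
    have hc : ContinuousAt (fun A => (ψ A).2.det) (matK x₀ ^ 2) :=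
      (continuous_id.matrix_det.continuousAt (x := (ψ (matK x₀ ^ 2)).2)).comp
        (f := fun A => (ψ A).2) hcont.snd
    refine hc.eventually_ne ?_
    simp [hψ0]
  have hcf : ∀ᶠ A in 𝓝 (matK x₀ ^ 2), CollisionFree (ψ A).1 := by
    simp only [CollisionFree, eventually_all]
    intro i j hij
    have hc : ContinuousAt (fun A => Complex.sinh (((ψ A).1 i - (ψ A).1 j) / 2))
        (matK x₀ ^ 2) := by
      have h1 : Continuous fun x : Fin N → ℂ => Complex.sinh ((x i - x j) / 2) := by fun_prop
      exact (h1.continuousAt (x := (ψ (matK x₀ ^ 2)).1)).comp (f := fun A => (ψ A).1) hcont.fst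
    refine hc.eventually_ne ?_
    rw [hψ0]
    exact h i j hij
  filter_upwards [hψe, hψd.eventually (by simp), hunit, hcf] with A hA hAd hAu hAc
  have hdA := hAd.differentiableAt one_ne_zero
  refine ⟨hdA.fst, hdA.snd, ?_, ?_, ?_, hAc⟩
  · rw [matK_sq]
    exact sub_eq_zero.1 (congrArg Prod.fst hA)
  · ext i
    exact sub_eq_zero.1 (congrFun (congrArg Prod.snd hA) i)
  · exact (Matrix.isUnit_iff_isUnit_det _).2 (isUnit_iff_ne_zero.2 hAu)

end Existence

/-! ### Hamiltonian motion of the eigenvalues -/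

section Flow

open scoped Matrix.Norms.Operator

variable {N : ℕ}

/-- If `V` diagonalizes `A = Q₀ E`, where `E` commutes with `L₀`, and `V⁻¹` maps `K(x₀) e` to
`K(x) e`, then `V⁻¹ L₀ V` is a Lax matrix: the rank one matrix `Q₀ L₀ - L₀ Q₀ + Q₀` keeps its left
factor, and the right factor is then determined by the diagonal entries. -/
lemma conj_laxMatrix_eq {x₀ y₀ x : Fin N → ℂ} {E V : Matrix (Fin N) (Fin N) ℂ}
    (h₀ : CollisionFree x₀) (hx : CollisionFree x) (hE : Commute E (laxMatrix x₀ y₀))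
    (hV : IsUnit V) (hdiag : V * matK x ^ 2 = matK x₀ ^ 2 * E * V)
    (hu : V.mulVec (expHalf x) = expHalf x₀) :
    V⁻¹ * laxMatrix x₀ y₀ * V = laxMatrix x fun i => (V⁻¹ * laxMatrix x₀ y₀ * V) i i := by
  have hVd := (Matrix.isUnit_iff_isUnit_det _).1 hV
  have h1 : V⁻¹ * V = 1 := Matrix.nonsing_inv_mul _ hVd
  have h2 : V * V⁻¹ = 1 := Matrix.mul_nonsing_inv _ hVd
  set L₀ := laxMatrix x₀ y₀ with hL₀
  set Q₀ : Matrix (Fin N) (Fin N) ℂ := matK x₀ ^ 2 with hQ₀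
  set Q : Matrix (Fin N) (Fin N) ℂ := matK x ^ 2 with hQ
  set Y := V⁻¹ * L₀ * V with hY
  have hR₀ : Q₀ * L₀ - L₀ * Q₀ + Q₀ = Matrix.vecMulVec (expHalf x₀) (expHalf x₀) := by
    ext a b
    rw [Matrix.add_apply, Matrix.sub_apply, hQ₀, matK_sq, Matrix.diagonal_mul, Matrix.mul_diagonal,
      Matrix.vecMulVec_apply]
    simp only [expHalf]
    by_cases h : a = b
    · subst h; simp; ring
    · rw [hL₀, laxMatrix_apply_ne _ h, Matrix.diagonal_apply_ne _ h]
      have := sinh_half_sub_ne_zero_iff.1 (h₀ a b h)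
      field_simp
      ring
  have hQV : Q = V⁻¹ * (Q₀ * E) * V := by
    rw [mul_assoc, ← hdiag, ← mul_assoc, h1, one_mul]
  have hu' : V⁻¹.mulVec (expHalf x₀) = expHalf x := by
    rw [← hu, Matrix.mulVec_mulVec, h1, Matrix.one_mulVec]
  set w := Matrix.vecMul (expHalf x₀) (E * V) with hw
  have hR : Q * Y - Y * Q + Q = Matrix.vecMulVec (expHalf x) w := by
    calc Q * Y - Y * Q + Q
        = V⁻¹ * Q₀ * E * (V * V⁻¹) * L₀ * V - V⁻¹ * L₀ * (V * V⁻¹) * Q₀ * E * V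
          + V⁻¹ * Q₀ * E * V := by rw [hQV, hY]; noncomm_ring
      _ = V⁻¹ * Q₀ * (E * L₀) * V - V⁻¹ * L₀ * Q₀ * E * V + V⁻¹ * Q₀ * E * V := by
          rw [h2]; noncomm_ring
      _ = V⁻¹ * (Q₀ * L₀ - L₀ * Q₀ + Q₀) * (E * V) := by rw [hE.eq]; noncomm_ring
      _ = _ := by rw [hR₀, Matrix.mul_vecMulVec, hu', Matrix.vecMulVec_mul]
  have hij := fun i j => congrFun (congrFun hR i) j
  simp only [hQ, matK_sq, Matrix.add_apply, Matrix.sub_apply, Matrix.diagonal_mul,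
    Matrix.mul_diagonal, Matrix.vecMulVec_apply, expHalf] at hij
  have hwj : ∀ j, w j = Complex.exp (x j / 2) := fun j => by
    have h3 := hij j j
    rw [Matrix.diagonal_apply_eq] at h3
    refine mul_left_cancel₀ (Complex.exp_ne_zero (x j / 2)) ?_
    rw [← h3]; ring
  ext i j
  by_cases h : i = j
  · subst h; simp [laxMatrix]
  · have h3 := hij i j
    rw [Matrix.diagonal_apply_ne _ h, hwj] at h3
    rw [laxMatrix_apply_ne _ h, eq_div_iff (sinh_half_sub_ne_zero_iff.1 (hx i j h)), ← h3]
    ring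

lemma hasDerivAt_matrix_inv {V : ℂ → Matrix (Fin N) (Fin N) ℂ} {V' : Matrix (Fin N) (Fin N) ℂ}
    {z : ℂ} (hV : HasDerivAt V V' z) (hu : IsUnit (V z)) :
    HasDerivAt (fun w => (V w)⁻¹) (-((V z)⁻¹ * V' * (V z)⁻¹)) z := by
  obtain ⟨U, hU⟩ := hu
  have h := hasFDerivAt_ringInverse (𝕜 := ℂ) U
  rw [hU] at h
  have h2 := h.comp_hasDerivAt z hV
  have e : (Ring.inverse ∘ V) = fun w => (V w)⁻¹ := by
    ext1 w
    exact (Matrix.nonsing_inv_eq_ringInverse (V w)).symm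
  rw [e] at h2
  refine h2.congr_deriv ?_
  have e2 : ((U⁻¹ : (Matrix (Fin N) (Fin N) ℂ)ˣ) : Matrix (Fin N) (Fin N) ℂ) = (V z)⁻¹ := by
    rw [← hU, Matrix.coe_units_inv]
  rw [← e2]
  rfl

lemma flowMatrix_conj {V : Matrix (Fin N) (Fin N) ℂ} (hV : IsUnit V) (k : ℕ+)
    (L : Matrix (Fin N) (Fin N) ℂ) : flowMatrix k (V⁻¹ * L * V) = V⁻¹ * flowMatrix k L * V := by
  rw [flowMatrix_eq_aeval, flowMatrix_eq_aeval, aeval_conj hV]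

/-- The eigenvalues of a matrix moving by `A' = -A (L₀^k - (L₀ - 1)^k)`, together with the diagonal
of `L₀` in the moving eigenbasis, follow the `k`-th Hamiltonian flow. -/
lemma hasDerivAt_of_diagonalization {x : ℂ → Fin N → ℂ} {V A : ℂ → Matrix (Fin N) (Fin N) ℂ}
    {L₀ : Matrix (Fin N) (Fin N) ℂ} {z : ℂ} {k : ℕ+} (hx : DifferentiableAt ℂ x z)
    (hV : DifferentiableAt ℂ V z) (hA : HasDerivAt A (-(A z * flowMatrix k L₀)) z)
    (heq : ∀ᶠ w in 𝓝 z, V w * matK (x w) ^ 2 = A w * V w)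
    (hu : IsUnit (V z)) (hcf : CollisionFree (x z))
    (hlax : (V z)⁻¹ * L₀ * V z = laxMatrix (x z) fun i => ((V z)⁻¹ * L₀ * V z) i i) (i : Fin N) :
    HasDerivAt (fun w => x w i) (dHdy k i (x z) fun i => ((V z)⁻¹ * L₀ * V z) i i) z ∧
    HasDerivAt (fun w => ((V w)⁻¹ * L₀ * V w) i i)
      (-dHdx k i (x z) fun i => ((V z)⁻¹ * L₀ * V z) i i) z := by
  have hVd := (Matrix.isUnit_iff_isUnit_det _).1 hu
  have h1 : (V z)⁻¹ * V z = 1 := Matrix.nonsing_inv_mul _ hVd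
  have h2 : V z * (V z)⁻¹ = 1 := Matrix.mul_nonsing_inv _ hVd
  obtain ⟨V', hVz⟩ : ∃ V', HasDerivAt V V' z := ⟨_, hV.hasDerivAt⟩
  obtain ⟨x', hxz⟩ : ∃ x' : Fin N → ℂ, ∀ i, HasDerivAt (fun w => x w i) (x' i) z :=
    ⟨_, hasDerivAt_pi.1 hx.hasDerivAt⟩
  rw [dHdy_eq k i hcf, dHdx_eq k i hcf, ← hlax, neg_neg]
  set L := (V z)⁻¹ * L₀ * V z with hL
  have hΦ : flowMatrix k L = (V z)⁻¹ * flowMatrix k L₀ * V z := flowMatrix_conj hu k L₀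
  set Φ := flowMatrix k L with hΦdef
  set M := (V z)⁻¹ * V' with hM
  -- differentiate `V K² = A V`
  have hQ : HasDerivAt (fun w => matK (x w) ^ 2)
      (Matrix.diagonal fun i => Complex.exp (x z i / 2) ^ 2 * x' i) z := by
    simp only [matK_sq]
    refine hasDerivAt_matrix.2 fun i j => ?_
    by_cases h : i = j
    · subst h
      simp only [Matrix.diagonal_apply_eq]
      refine ((((hxz i).div_const 2).cexp).fun_pow 2).congr_deriv ?_
      simp
      ring
    · simp only [Matrix.diagonal_apply_ne _ h]
      exact hasDerivAt_const _ _
  have hprod : V' * matK (x z) ^ 2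
      + V z * Matrix.diagonal (fun i => Complex.exp (x z i / 2) ^ 2 * x' i)
      = -(A z * flowMatrix k L₀) * V z + A z * V' :=
    ((hVz.mul hQ).congr_of_eventuallyEq (EventuallyEq.symm heq)).unique (hA.mul hVz)
  have hz := heq.self_of_nhds
  have hQM : Matrix.diagonal (fun i => Complex.exp (x z i / 2) ^ 2 * x' i)
      = matK (x z) ^ 2 * M - M * matK (x z) ^ 2 - matK (x z) ^ 2 * Φ := by
    have hQz : matK (x z) ^ 2 = (V z)⁻¹ * A z * V z := by
      rw [mul_assoc, ← hz, ← mul_assoc, h1, one_mul]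
    have e1 : (V z)⁻¹ * (V' * matK (x z) ^ 2
        + V z * Matrix.diagonal (fun i => Complex.exp (x z i / 2) ^ 2 * x' i))
        = M * matK (x z) ^ 2
          + Matrix.diagonal (fun i => Complex.exp (x z i / 2) ^ 2 * x' i) := by
      rw [mul_add, ← mul_assoc, ← mul_assoc, h1, one_mul]
    have e2 : (V z)⁻¹ * (-(A z * flowMatrix k L₀) * V z + A z * V')
        = matK (x z) ^ 2 * M - matK (x z) ^ 2 * Φ := by
      calc _ = (V z)⁻¹ * A z * 1 * V' - (V z)⁻¹ * A z * 1 * flowMatrix k L₀ * V z := by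
            noncomm_ring
        _ = _ := by rw [← h2, hQz, hM, hΦ]; noncomm_ring
    rw [← hprod, e1] at e2
    rw [sub_right_comm, ← e2]
    abel
  have hent := fun i j => congrFun (congrFun hQM i) j
  simp only [matK_sq, Matrix.sub_apply, Matrix.diagonal_mul, Matrix.mul_diagonal] at hent
  have hMij : ∀ i j, i ≠ j → M i j = Complex.exp (x z i / 2) ^ 2 * Φ i j
      / (Complex.exp (x z i / 2) ^ 2 - Complex.exp (x z j / 2) ^ 2) := fun i j hij => by
    have h3 := hent i j
    rw [Matrix.diagonal_apply_ne _ hij] at h3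
    rw [eq_div_iff (sinh_half_sub_ne_zero_iff.1 (hcf i j hij))]
    linear_combination -h3
  constructor
  · refine (hxz i).congr_deriv ?_
    have h3 := hent i i
    rw [Matrix.diagonal_apply_eq] at h3
    refine mul_left_cancel₀ (pow_ne_zero 2 (Complex.exp_ne_zero (x z i / 2))) ?_
    linear_combination h3
  · have hY := ((hasDerivAt_matrix_inv hVz hu).mul_const L₀).mul hVz
    have e : -((V z)⁻¹ * V' * (V z)⁻¹) * L₀ * V z + (V z)⁻¹ * L₀ * V' = L * M - M * L := by
      calc _ = (V z)⁻¹ * L₀ * 1 * V' - (V z)⁻¹ * V' * ((V z)⁻¹ * L₀ * V z) := by noncomm_ring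
        _ = _ := by rw [← h2, hM, hL]; noncomm_ring
    refine (hasDerivAt_matrix.1 (hY.congr_deriv e) i i).congr_deriv ?_
    have hd := fun i j (h : i ≠ j) => sinh_half_sub_ne_zero_iff.1 (hcf i j h)
    rw [lax_commutator_diag hd (Φ := Φ) ?_ (mul_flowMatrix k L) hMij i]
    · rfl
    · intro i j hij
      rw [hlax]
      exact laxMatrix_apply_ne _ hij

end Flow

/-! ### Solutions for small times -/

section SmallTimes

lemma mem_smallTimes_of_norm_le {R ε : ℝ} (hR : 0 < R) {s t : ℕ+ → ℂ} (ht : t ∈ smallTimes R ε)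
    (h : ∀ k, ‖s k‖ ≤ ‖t k‖) : s ∈ smallTimes R ε := by
  have hle : ∀ k : ℕ+, ‖s k‖ * R ^ (k : ℕ) ≤ ‖t k‖ * R ^ (k : ℕ) := fun k =>
    mul_le_mul_of_nonneg_right (h k) (by positivity)
  have hs : Summable fun k : ℕ+ => ‖s k‖ * R ^ (k : ℕ) :=
    Summable.of_nonneg_of_le (fun k => by positivity) hle ht.1
  exact ⟨hs, (hs.tsum_le_tsum hle ht.1).trans_lt ht.2⟩

lemma isTimeDomain_smallTimes {R ε : ℝ} (hR : 0 < R) (hε : 0 < ε) :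
    IsTimeDomain (smallTimes R ε) := by
  refine ⟨⟨by simp, by simpa using hε⟩, fun t ht => Eventually.of_forall fun m => ?_⟩
  induction m with
  | zero =>
    have : truncTimes 0 t = 0 := by ext k; simp [truncTimes]
    rw [this]
  | succ m ih =>
    refine ih.tail ⟨m.succPNat, t m.succPNat, ?_, fun s hs => ?_⟩
    · ext1 k
      by_cases hk : k = m.succPNat
      · subst hk; simp [truncTimes]
      · have : (k : ℕ) ≠ m + 1 := fun h => hk (PNat.eq (by simpa using h))
        rw [Function.update_of_ne hk, truncTimes, truncTimes]
        congr 1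
        rw [eq_iff_iff]
        omega
    · refine mem_smallTimes_of_norm_le hR ht fun k => ?_
      by_cases hk : k = m.succPNat
      · subst hk
        rw [Function.update_self]
        have h0 : truncTimes m t m.succPNat = 0 := by simp [truncTimes]
        rw [h0] at hs
        have hb : segment ℝ 0 (t m.succPNat) ⊆ Metric.closedBall 0 ‖t m.succPNat‖ :=
          (convex_closedBall _ _).segment_subset (by simp) (by simp)
        simpa using hb hs
      · rw [Function.update_of_ne hk, truncTimes]
        split_ifs <;> simp

open scoped Matrix.Norms.Operator

variable {N : ℕ}

lemma norm_smul_pow_le {A : Matrix (Fin N) (Fin N) ℂ} {R : ℝ} (h : ‖A‖ ≤ R) (c : ℂ) (k : ℕ+) :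
    ‖c • A ^ (k : ℕ)‖ ≤ ‖c‖ * R ^ (k : ℕ) := by
  rw [norm_smul]
  gcongr
  exact (norm_pow_le' A k.pos).trans (pow_le_pow_left₀ (norm_nonneg _) h _)

lemma timesConverge_of_mem_smallTimes {Z : Matrix (Fin N) (Fin N) ℂ} {R ε : ℝ} (h : ‖Z‖ ≤ R)
    (h' : ‖Z - 1‖ ≤ R) {t : ℕ+ → ℂ} (ht : t ∈ smallTimes R ε) : TimesConverge Z t :=
  ⟨Summable.of_norm_bounded ht.1 fun k => norm_smul_pow_le h (t k) k,
    Summable.of_norm_bounded ht.1 fun k => norm_smul_pow_le h' (t k) k⟩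

lemma norm_timeSum_lt {Z : Matrix (Fin N) (Fin N) ℂ} {R ε : ℝ} (h : ‖Z‖ ≤ R)
    (h' : ‖Z - 1‖ ≤ R) {t : ℕ+ → ℂ} (ht : t ∈ smallTimes R ε) : ‖timeSum Z t‖ < 2 * ε := by
  have hle : ∀ k : ℕ+, ‖t k • flowMatrix k Z‖ ≤ 2 * (‖t k‖ * R ^ (k : ℕ)) := fun k => by
    rw [flowMatrix, smul_sub, two_mul]
    exact (norm_sub_le _ _).trans (add_le_add (norm_smul_pow_le h _ k) (norm_smul_pow_le h' _ k))
  have := tsum_of_norm_bounded (ht.1.mul_left 2).hasSum hle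
  rw [tsum_mul_left] at this
  exact this.trans_lt (mul_lt_mul_of_pos_left ht.2 two_pos)

/-- The solution of the hierarchy is obtained by diagonalizing `K(x₀)² exp (-∑ t_k (L₀^k -
(L₀ - 1)^k))`. -/
lemma exists_solution {x₀ y₀ : Fin N → ℂ} (h₀ : CollisionFree x₀) {R : ℝ} (hR : 0 < R)
    (hL : ‖laxMatrix x₀ y₀‖ ≤ R) (hL' : ‖laxMatrix x₀ y₀ - 1‖ ≤ R) :
    ∃ ε > 0, ∃ x y : (ℕ+ → ℂ) → Fin N → ℂ, IsTrigCMSolution x₀ y₀ (smallTimes R ε) x y := by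
  obtain ⟨ξ, V, hξ0, hV0, hev⟩ := exists_local_diagonalization h₀
  set L₀ := laxMatrix x₀ y₀ with hL₀
  set Q₀ : Matrix (Fin N) (Fin N) ℂ := matK x₀ ^ 2 with hQ₀
  let G : Matrix (Fin N) (Fin N) ℂ → Matrix (Fin N) (Fin N) ℂ := fun S => Q₀ * NormedSpace.exp (-S)
  have hG0 : G 0 = Q₀ := by simp [G]
  have hGc : Continuous G :=
    continuous_const.mul (differentiable_exp_matrix.continuous.comp continuous_neg)
  have hGt : Tendsto G (𝓝 0) (𝓝 Q₀) := by
    have := hGc.tendsto 0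
    rwa [hG0] at this
  have hev' := hGt.eventually (eventually_eventually_nhds.2 hev)
  obtain ⟨δ, hδ, hball⟩ := Metric.eventually_nhds_iff_ball.1 hev'
  refine ⟨δ / 2, by positivity, fun t => ξ (G (timeSum L₀ t)),
    fun t i => ((V (G (timeSum L₀ t)))⁻¹ * L₀ * V (G (timeSum L₀ t))) i i, ?_⟩
  have hgood := fun t (ht : t ∈ smallTimes R (δ / 2)) => hball (timeSum L₀ t) (by
    have := norm_timeSum_lt hL hL' ht
    rw [mem_ball_zero_iff]
    linarith)
  have hsum : ∀ t ∈ smallTimes R (δ / 2), Summable fun k : ℕ+ => t k • flowMatrix k L₀ :=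
    fun t ht => (hasSum_flowMatrix_of_timesConverge
      (timesConverge_of_mem_smallTimes hL hL' ht)).summable
  have hzero : timeSum L₀ 0 = 0 := by simp [timeSum]
  have hcomm : ∀ t, Commute L₀ (timeSum L₀ t) := fun t =>
    Commute.tsum_right _ fun k => Commute.smul_right (mul_flowMatrix k L₀) _
  have hcommΦ : ∀ t k, Commute (timeSum L₀ t) (flowMatrix k L₀) := fun t k =>
    ((hcomm t).symm.pow_right _).sub_right
      (((hcomm t).symm.sub_right (Commute.one_right _)).pow_right _)
  have hflow : ∀ t ∈ smallTimes R (δ / 2), ∀ (k : ℕ+) (i : Fin N),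
      HasDerivAt (fun s => ξ (G (timeSum L₀ (Function.update t k s))) i)
        (dHdy k i (ξ (G (timeSum L₀ t)))
          fun i => ((V (G (timeSum L₀ t)))⁻¹ * L₀ * V (G (timeSum L₀ t))) i i) (t k) ∧
      HasDerivAt (fun s => ((V (G (timeSum L₀ (Function.update t k s))))⁻¹ * L₀
          * V (G (timeSum L₀ (Function.update t k s)))) i i)
        (-dHdx k i (ξ (G (timeSum L₀ t)))
          fun i => ((V (G (timeSum L₀ t)))⁻¹ * L₀ * V (G (timeSum L₀ t))) i i) (t k) := by
    intro t ht k i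
    have hg := hgood t ht
    obtain ⟨hξd, hVd, hdiag, hu, hunit, hcf⟩ := hg.self_of_nhds
    let A : ℂ → Matrix (Fin N) (Fin N) ℂ := fun s => G (timeSum L₀ (Function.update t k s))
    have hAt : A (t k) = G (timeSum L₀ t) := by simp [A]
    have hAeq : A = fun s => G (timeSum L₀ t) * NormedSpace.exp ((s - t k) • -flowMatrix k L₀) := by
      ext1 s
      simp only [A, G]
      rw [timeSum_update (hsum t ht), mul_assoc, ← Matrix.exp_add_of_commute]
      · congr 2
        rw [smul_neg]; abel
      · exact (((hcommΦ t k).neg_right).smul_right _).neg_left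
    have hA : HasDerivAt A (-(A (t k) * flowMatrix k L₀)) (t k) := by
      rw [hAt, hAeq]
      have he := (hasDerivAt_exp_smul_const (-flowMatrix k L₀) (t k - t k)).comp_sub_const
        (t k) (t k)
      have he2 : HasDerivAt (fun s => G (timeSum L₀ t) *
        NormedSpace.exp ((s - t k) • -flowMatrix k L₀)) _ (t k) :=
          he.const_mul (G (timeSum L₀ t))
      refine he2.congr_deriv ?_
      simp
    have key := hasDerivAt_of_diagonalization (x := fun s => ξ (A s)) (V := fun s => V (A s))
      (A := A) (L₀ := L₀) (z := t k) (k := k)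
      (DifferentiableAt.comp (t k) (by rw [hAt]; exact hξd) hA.differentiableAt)
      (DifferentiableAt.comp (t k) (by rw [hAt]; exact hVd) hA.differentiableAt) hA
      (by
        have hc : Tendsto A (𝓝 (t k)) (𝓝 (G (timeSum L₀ t))) := by
          have := hA.continuousAt.tendsto
          rwa [hAt] at this
        exact (hc.eventually hg).mono fun s hs => hs.2.2.1)
      (by rw [hAt]; exact hunit) (by rw [hAt]; exact hcf)
      (by
        rw [hAt]
        exact conj_laxMatrix_eq h₀ hcf ((hcomm t).neg_right.exp_right.symm) hunit hdiag hu) i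
    rw [hAt] at key
    exact key
  refine ⟨isTimeDomain_smallTimes hR (by positivity), ?_, ?_, ?_, ?_, ?_, ?_, ?_⟩
  · rw [hzero, hG0, hξ0]
  · ext i
    rw [hzero, hG0, hV0]
    simp [hL₀, laxMatrix]
  · exact fun t ht => (hgood t ht).self_of_nhds.2.2.2.2.2
  · exact fun t ht k i => (hflow t ht k i).1.hasDerivWithinAt
  · exact fun t ht k i => (hflow t ht k i).2.hasDerivWithinAt
  · intro t ht
    have h1 := tendsto_timeSum_truncTimes (hsum t ht)
    exact ((hgood t ht).self_of_nhds.1.continuousAt.tendsto).comp ((hGc.tendsto _).comp h1)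
  · intro t ht
    have h1 := (hGc.tendsto _).comp (tendsto_timeSum_truncTimes (hsum t ht))
    obtain ⟨-, hVd, -, -, hunit, -⟩ := (hgood t ht).self_of_nhds
    have hV1 := hVd.continuousAt.tendsto.comp h1
    have hV2 : Tendsto (fun m => (V (G (timeSum L₀ (truncTimes m t))))⁻¹) atTop
        (𝓝 (V (G (timeSum L₀ t)))⁻¹) := by
      obtain ⟨U, hU⟩ := hunit
      have h2 := (NormedRing.inverse_continuousAt U).tendsto
      rw [hU] at h2
      simp only [Matrix.nonsing_inv_eq_ringInverse]
      exact h2.comp hV1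
    have h3 := (hV2.mul_const L₀).mul hV1
    refine tendsto_pi_nhds.2 fun i => ?_
    exact (tendsto_pi_nhds.1 (tendsto_pi_nhds.1 h3 i) i)

end SmallTimes

/-! ### The trigonometric Calogero-Moser hierarchy -/

theorem theorem1 {N : ℕ} (X Z : Matrix (Fin N) (Fin N) ℂ)
    (hXZ : IsTrigCMPair X Z) (hX : MatrixDiagonalizable X) :
    (∃ (U : Matrix (Fin N) (Fin N) ℂ) (x₀ y₀ : Fin N → ℂ), IsDiagonalizingData X Z U x₀ y₀) ∧
    ∀ (U : Matrix (Fin N) (Fin N) ℂ) (x₀ y₀ : Fin N → ℂ), IsDiagonalizingData X Z U x₀ y₀ →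
      CollisionFree x₀ ∧
      (∃ R > 0, ∃ ε > 0,
        (∀ t ∈ smallTimes R ε, TimesConverge Z t) ∧
        ∃ x y : (ℕ+ → ℂ) → Fin N → ℂ, IsTrigCMSolution x₀ y₀ (smallTimes R ε) x y) ∧
      ∀ (Ω : Set (ℕ+ → ℂ)) (x y : (ℕ+ → ℂ) → Fin N → ℂ),
        IsTrigCMSolution x₀ y₀ Ω x y →
        ∀ t ∈ Ω, TimesConverge Z t → ∀ ξ : ℂ,
          tauDet X (Z - 1) Z (shiftFirst ξ t) =
            Complex.exp (∑ i, (x t i - ξ) / 2) *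
              ∏ i, (2 * Complex.sinh ((ξ - x t i) / 2)) := by
  refine ⟨hXZ.exists_diagonalizingData hX, fun U x₀ y₀ hU => ?_⟩
  have hcf := hU.collisionFree hXZ
  refine ⟨hcf, ?_, fun Ω x y hsol t ht hc ξ => hsol.tauDet_eq hU ht hc ξ⟩
  open scoped Matrix.Norms.Operator in
  obtain ⟨R, hR, hZ, hZ', hL, hL'⟩ : ∃ R : ℝ, 0 < R ∧ ‖Z‖ ≤ R ∧ ‖Z - 1‖ ≤ R ∧
      ‖laxMatrix x₀ y₀‖ ≤ R ∧ ‖laxMatrix x₀ y₀ - 1‖ ≤ R := by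
    have h1 := norm_nonneg Z
    have h2 := norm_nonneg (Z - 1)
    have h3 := norm_nonneg (laxMatrix x₀ y₀)
    have h4 := norm_nonneg (laxMatrix x₀ y₀ - 1)
    exact ⟨‖Z‖ + ‖Z - 1‖ + ‖laxMatrix x₀ y₀‖ + ‖laxMatrix x₀ y₀ - 1‖ + 1, by linarith,
      by linarith, by linarith, by linarith, by linarith⟩
  obtain ⟨ε, hε, x, y, hxy⟩ := exists_solution hcf hR hL hL'
  exact ⟨R, hR, ε, hε, fun t ht => timesConverge_of_mem_smallTimes hZ hZ' ht, x, y, hxy⟩
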